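/- Let $\Omega\subset\mathbb{C}$ be a bounded open set with $C^\infty$ boundary such that $\overline\Omega$ is strictly convex, let $q=1_\Omega$ and $\sigma\in\{1,-1\}$. For $k\in\mathbb{C}$ with $|k|\ge 1$ put $$Au(z)=\frac1{2\pi}\int_\Omega \frac{e^{-kw+\overline{kw}}}{z-w}\,u(w)\,L(dw),\qquad Bu(z)=\frac{\sigma}{2\pi}\int_\Omega \frac{e^{kw-\overline{kw}}}{\overline z-\overline w}\,u(w)\,L(dw),$$ where $L(dw)$ is Lebesgue measure on $\mathbb{C}$; that is, $A=(h\overline\partial)^{-1}e^{\overline{k\cdot}-k\cdot}\frac{hq}{2}$ and $B=\sigma(h\partial)^{-1}e^{k\cdot-\overline{k\cdot}}\frac{h\overline q}{2}$ with $h=1/|k|$, where $(h\overline\partial)^{-1}$ and $(h\partial)^{-1}$ denote convolution with $1/(\pi h z)$ and $1/(\pi h\overline z)$. Write $\langle z\rangle=(1+|z|^2)^{1/2}$ and let $\langle\cdot\rangle^{\epsilon}L^p=\{f:\langle\cdot\rangle^{-\epsilon}f\in L^p(\mathbb{C})\}$, with norm $\|\langle\cdot\rangle^{-\epsilon}f\|_{L^p}$.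 For every $1<p<\infty$, every $|k|\ge1$ and every $u\in L^p(\mathbb{C})$, the integrals defining $Bu(z)$ and $A(Bu)(z)$ converge absolutely for almost every $z\in\mathbb{C}$. Moreover: 1. If $2<p<\infty$, there is a constant $C$, depending only on $\Omega$ and $p$, such that $ABu\in L^p(\mathbb{C})$ and $$\|ABu\|_{L^p}\le \frac{C}{|k|}\,\|u\|_{L^p}\qquad\text{for all } u\in L^p(\mathbb{C}),\ |k|\ge 1.$$ 2. If $1<p\le 2$ and $\epsilon>\frac2p-1$, there is a constant $C$, depending only on $\Omega$, $p$ and $\epsilon$, such that $ABu\in\langle\cdot\rangle^{\epsilon}L^p$ and $$\|\langle\cdot\rangle^{-\epsilon}ABu\|_{L^p}\le \frac{C}{|k|}\,\|u\|_{L^p}\qquad\text{for all } u\in L^p(\mathbb{C}),\ |k|\ge 1.$$ -/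

import Mathlib

open MeasureTheory
open scoped ContDiff ComplexConjugate

noncomputable section

/-- A planar set has smooth boundary: near every boundary point it is the strict sublevel set
`{ρ < 0}` of a real `C^∞` function `ρ` with nonzero differential at that point. -/
def HasSmoothBoundary (Ω : Set ℂ) : Prop :=
  ∀ p ∈ frontier Ω, ∃ U : Set ℂ, ∃ ρ : ℂ → ℝ,
    IsOpen U ∧ p ∈ U ∧ ContDiffOn ℝ ∞ ρ U ∧ fderiv ℝ ρ p ≠ 0 ∧ ∀ z ∈ U, (z ∈ Ω ↔ ρ z < 0)

/-- A bounded open strictly convex planar set with smooth boundary.  Strict convexity is that of the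
closed set: open chords between distinct points of the closure lie in the interior of the closure.
(For the open set itself `StrictConvex` would only say `Convex`.) -/
structure IsStrictlyConvexSmoothDomain (Ω : Set ℂ) : Prop where
  isOpen : IsOpen Ω
  isBounded : Bornology.IsBounded Ω
  strictConvex : StrictConvex ℝ (closure Ω)
  smooth : HasSmoothBoundary Ω

/-- The Japanese bracket `⟨z⟩ = (1 + |z|²)^{1/2}`. -/
def japaneseBracket (z : ℂ) : ℝ := Real.sqrt (1 + ‖z‖ ^ 2)

/-- The operator of multiplication by the oscillating factor `e^{kz - conj(kz)}`;
multiplication by the inverse factor `e^{conj(kz) - kz}` is `oscMul (-k)`. -/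
def oscMul (k : ℂ) (u : ℂ → ℂ) (z : ℂ) : ℂ :=
  Complex.exp (k * z - conj (k * z)) * u z

/-- `(h ∂̄)⁻¹`, convolution with the fundamental solution `1 / (π h z)` of `h ∂̄`. -/
def dbarInv (h : ℝ) (f : ℂ → ℂ) (z : ℂ) : ℂ :=
  1 / ((Real.pi * h : ℝ) : ℂ) * ∫ w : ℂ, f w / (z - w)

/-- `(h ∂)⁻¹`, convolution with the fundamental solution `1 / (π h conj z)` of `h ∂`. -/
def dInv (h : ℝ) (f : ℂ → ℂ) (z : ℂ) : ℂ :=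
  1 / ((Real.pi * h : ℝ) : ℂ) * ∫ w : ℂ, f w / conj (z - w)

/-- The function to which `(h ∂̄)⁻¹` is applied in `opA`: `e^{conj(kw) - kw} (h / 2) q u`,
where `h = 1/|k|`. -/
def sourceA (q : ℂ → ℂ) (k : ℂ) (u : ℂ → ℂ) : ℂ → ℂ :=
  oscMul (-k) (fun w => ((1 / ‖k‖ : ℝ) : ℂ) * q w / 2 * u w)

/-- The function to which `(h ∂)⁻¹` is applied in `opB`: `e^{kw - conj(kw)} (h / 2) (conj q) u`,
where `h = 1/|k|`. -/
def sourceB (q : ℂ → ℂ) (k : ℂ) (u : ℂ → ℂ) : ℂ → ℂ :=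
  oscMul k (fun w => ((1 / ‖k‖ : ℝ) : ℂ) * conj (q w) / 2 * u w)

/-- `A u = (h ∂̄)⁻¹ (e^{conj(kw) - kw} (h / 2) q u)`, `h = 1/|k|`, that is
`A u (z) = (2π)⁻¹ ∫ (z - w)⁻¹ e^{-kw + conj(kw)} q(w) u(w) L(dw)`. -/
def opA (q : ℂ → ℂ) (k : ℂ) (u : ℂ → ℂ) : ℂ → ℂ :=
  dbarInv (1 / ‖k‖) (sourceA q k u)

/-- `B u = σ (h ∂)⁻¹ (e^{kw - conj(kw)} (h / 2) (conj q) u)`, `h = 1/|k|`, that is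
`B u (z) = σ (2π)⁻¹ ∫ (conj z - conj w)⁻¹ e^{kw - conj(kw)} (conj q)(w) u(w) L(dw)`. -/
def opB (q : ℂ → ℂ) (σ : ℝ) (k : ℂ) (u : ℂ → ℂ) : ℂ → ℂ :=
  fun z => (σ : ℂ) * dInv (1 / ‖k‖) (sourceB q k u) z

/-- The composition `AB`. -/
def opAB (q : ℂ → ℂ) (σ : ℝ) (k : ℂ) (u : ℂ → ℂ) : ℂ → ℂ :=
  opA q k (opB q σ k u)

/-- The integrals defining `B u (z)` and `A (B u) (z)` converge absolutely for almost every `z`. -/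
def OpABConverges (q : ℂ → ℂ) (σ : ℝ) (k : ℂ) (u : ℂ → ℂ) : Prop :=
  (∀ᵐ z : ℂ, Integrable (fun w => sourceB q k u w / conj (z - w))) ∧
  (∀ᵐ z : ℂ, Integrable (fun w => sourceA q k (opB q σ k u) w / (z - w)))

/-- `T k = 𝒪(1/|k|)` (for `|k| ≥ 1`) as operators `L^p(ℂ) → ⟨·⟩^ε L^p(ℂ)`, where `⟨·⟩^ε L^p` is
normed by `‖f‖ = ‖⟨·⟩^{-ε} f‖_{L^p}`.  For `ε = 0` the target is `L^p(ℂ)`. -/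
def IsBigOInvAbs (T : ℂ → (ℂ → ℂ) → ℂ → ℂ) (p : ℝ) (ε : ℝ) : Prop :=
  ∃ C : ℝ, ∀ k : ℂ, 1 ≤ ‖k‖ → ∀ u : ℂ → ℂ, MemLp u (ENNReal.ofReal p) volume →
    MemLp (fun z => (japaneseBracket z ^ (-ε)) • T k u z) (ENNReal.ofReal p) volume ∧
    eLpNorm (fun z => (japaneseBracket z ^ (-ε)) • T k u z) (ENNReal.ofReal p) volume ≤
      ENNReal.ofReal (C / ‖k‖) * eLpNorm u (ENNReal.ofReal p) volume

end

/-! The factors `h` cancel, so up to a constant `ABu(z)` is the integral over `v ∈ Ω` of `e(v) (z -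
v)⁻¹ ∫ f(w) / conj (v - w)`, with `|e| = 1` and `|f| = |u|` on `Ω`, `f = 0` elsewhere. All decay in
`k` comes from the oscillation of `e`. It changes sign under translation by `η = iπ/(2k)`, so for
`Q` the remaining factor, `4 ∫ e Q = ∫ e (2Q - Q(· + η) - Q(· - η))`: a discrete double integration
by parts (`enorm_integral_mul_le_second_difference`). A first difference would turn `|x|⁻¹` into
about `|η| |x|⁻²`, at the cost of a logarithm; the second gives `|η|² |x|⁻³`, integrable at infinity
in the plane.

For fixed `z, w` the second difference in `v` of `1_Ω(v) (z - v)⁻¹ conj(v - w)⁻¹` is bounded in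
`enorm_second_difference_pairKernel_le`. If `v` and `v ± η` all lie in `Ω`, one of the two Cauchy
kernels is replaced by `bumpKernel`, whose mass is `O(|η|)`. Otherwise those of the three points
that lie in `Ω` lie in a strip along the boundary, of width `O(|η|)` by convexity, and the crude
product of two Newton kernels is kept there. Integrating gives the positive operator `majorant`.

Its `L^p` bounds follow from the Schur test. A bump kernel gains `|η|` and the Newton kernel beside
it is bounded. In the strip term, passing from `Ω` into the strip gains `|η|^(1/p)` and passing from
the strip to the plane gains `|η|^(1 - 1/p)`, again `|η|` in total. Since `|η| = π/(2|k|)`, this is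
the claim.

The weight only concerns infinity: the Newton potential of a density on a bounded set decays like
`|z|⁻¹`, and `⟨z⟩^(-ε) |z|⁻¹` is in `L^p` there when `p(1 + ε) > 2`. This covers both `p > 2, ε = 0`
and `p ≤ 2, ε > 2/p - 1`. -/

/-! ### Convexity of the domain -/

/-- A set with smooth boundary and convex closure is convex: it is the interior of its closure. -/
theorem IsStrictlyConvexSmoothDomain.convex {Ω : Set ℂ} (hΩ : IsStrictlyConvexSmoothDomain Ω) :
    Convex ℝ Ω := by
  have hint : interior (closure Ω) = Ω := by
    refine Set.Subset.antisymm ?_ (interior_maximal subset_closure hΩ.isOpen)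
    intro p hp
    by_contra hpΩ
    have hfr : p ∈ frontier Ω := by
      rw [hΩ.isOpen.frontier_eq]
      exact ⟨interior_subset hp, hpΩ⟩
    obtain ⟨U, ρ, hU, hpU, hρ, hdρ, hΩρ⟩ := hΩ.smooth p hfr
    -- Points with `ρ > 0` are not limits of `Ω`, so near an interior point of the closure `ρ ≤ 0 ≤
    -- ρ p`: a boundary point there would be a local maximum of `ρ`.
    refine hdρ (IsLocalMax.fderiv_eq_zero ?_)
    have hp0 : 0 ≤ ρ p := not_lt.mp fun h => hpΩ ((hΩρ p hpU).2 h)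
    filter_upwards [isOpen_interior.mem_nhds hp, hU.mem_nhds hpU] with z hz hzU
    refine le_trans ?_ hp0
    by_contra hzpos
    have hev : ∀ᶠ y in nhds z, y ∉ Ω := by
      filter_upwards [hU.mem_nhds hzU, (hρ.continuousOn.continuousAt (hU.mem_nhds hzU)).eventually
        (lt_mem_nhds (not_le.mp hzpos))] with y hyU hy hyΩ
      exact absurd ((hΩρ y hyU).1 hyΩ) (not_lt.mpr hy.le)
    exact (mem_closure_iff_frequently.1 (interior_subset hz)) hev
  rw [← hint]
  exact hΩ.strictConvex.convex.interior

/-! ### Singular integrals over the plane and over boundary strips -/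

/-- A radial weight with an integrable singularity at the origin and integrable decay. -/
theorem lintegral_radial_ne_top {a s : ℝ} (hs : s < 2) (has : 2 < a + s) :
    ∫⁻ x : ℂ, (1 + ‖x‖ₑ) ^ (-a) * ‖x‖ₑ⁻¹ ^ s ≠ ⊤ := by
  have hint : Integrable (fun x : ℂ => (1 + ‖x‖) ^ (-a) * ‖x‖ ^ (-s)) := by
    rw [integrable_fun_norm_addHaar (E := ℂ) volume (f := fun r : ℝ => (1 + r) ^ (-a) * r ^ (-s))]
    rw [Complex.finrank_real_complex]
    have hmeas : Measurable fun y : ℝ => y ^ (2 - 1) • ((1 + y) ^ (-a) * y ^ (-s)) := by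
      simp only [smul_eq_mul]; fun_prop
    rw [← Set.Ioc_union_Ioi_eq_Ioi zero_le_one, integrableOn_union]
    constructor
    · have h1 : IntegrableOn (fun y : ℝ => y ^ (1 - s)) (Set.Ioc 0 1) := by
        rw [← intervalIntegrable_iff_integrableOn_Ioc_of_le zero_le_one]
        exact intervalIntegral.intervalIntegrable_rpow' (by linarith)
      refine h1.mono' hmeas.aestronglyMeasurable ?_
      filter_upwards [ae_restrict_mem measurableSet_Ioc] with y hy
      have hy0 := hy.1
      rw [Real.norm_of_nonneg (by positivity), sub_eq_add_neg, Real.rpow_add hy0]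
      simp only [smul_eq_mul, Real.rpow_one]
      norm_num
      refine mul_le_mul_of_nonneg_left ?_ hy0.le
      refine mul_le_of_le_one_left (by positivity) ?_
      exact Real.rpow_le_one_of_one_le_of_nonpos (by linarith) (by linarith)
    · have h1 : IntegrableOn (fun y : ℝ => y ^ (1 - s - a)) (Set.Ioi 1) :=
        integrableOn_Ioi_rpow_of_lt (by linarith) one_pos
      refine h1.mono' hmeas.aestronglyMeasurable ?_
      filter_upwards [ae_restrict_mem measurableSet_Ioi] with y hy
      have hy0 : 0 < y := lt_trans one_pos hy
      rw [Real.norm_of_nonneg (by positivity), show 1 - s - a = 1 + (-a + -s) by ring,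
        Real.rpow_add hy0, Real.rpow_add hy0]
      simp only [smul_eq_mul, Real.rpow_one]
      norm_num
      gcongr y * (?_ * _)
      exact Real.rpow_le_rpow_of_nonpos hy0 (by linarith) (by linarith)
  have := hint.hasFiniteIntegral.ne
  convert this using 1
  refine lintegral_congr_ae ?_
  filter_upwards [compl_mem_ae_iff.mpr (measure_singleton (0 : ℂ))] with x hx
  have hx0 : 0 < ‖x‖ := norm_pos_iff.mpr hx
  rw [Real.enorm_of_nonneg (by positivity), ENNReal.ofReal_mul (by positivity),
    ← ENNReal.ofReal_rpow_of_pos (by positivity), ← ENNReal.ofReal_rpow_of_pos hx0,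
    ENNReal.ofReal_add zero_le_one hx0.le, ofReal_norm, ENNReal.ofReal_one, ENNReal.rpow_neg _ s,
    ENNReal.inv_rpow]

/-- The part of `Ω` which the translation by `θ` moves out of `Ω`. -/
def exitStrip (Ω : Set ℂ) (θ : ℂ) : Set ℂ := {v | v ∈ Ω ∧ v + θ ∉ Ω}

theorem measurableSet_exitStrip {Ω : Set ℂ} (hΩ : IsOpen Ω) (θ : ℂ) :
    MeasurableSet (exitStrip Ω θ) :=
  hΩ.measurableSet.inter
    ((hΩ.preimage (continuous_id.add continuous_const)).measurableSet.compl)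

/-- If two points of a horizontal slice were more than `τ` apart, translating the left one by `τ`
would land on the segment between them, hence in `Ω`. -/
theorem volume_slice_exitStrip_le {Ω : Set ℂ} (hc : Convex ℝ Ω) {τ : ℝ} (hτ : 0 < τ) (y : ℝ) :
    volume {x : ℝ | (⟨x, y⟩ : ℂ) ∈ exitStrip Ω τ} ≤ ENNReal.ofReal τ := by
  refine (Real.volume_le_diam _).trans (Metric.ediam_le fun x hx x' hx' => ?_)
  have key : ∀ a b : ℝ, (⟨a, y⟩ : ℂ) ∈ exitStrip Ω τ → (⟨b, y⟩ : ℂ) ∈ exitStrip Ω τ →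
      b - a ≤ τ := by
    intro a b ha hb
    by_contra h
    push Not at h
    refine ha.2 (hc.segment_subset ha.1 hb.1 ?_)
    have hba : 0 < b - a := hτ.trans h
    obtain ⟨t, ht⟩ : ∃ t, t = τ / (b - a) := ⟨_, rfl⟩
    have h2 : (1 - t) * a + t * b = a + τ := by
      rw [ht]; field_simp; ring
    refine ⟨1 - t, t, ?_, by rw [ht]; positivity, by ring, ?_⟩
    · rw [ht, sub_nonneg, div_le_one hba]; exact h.le
    · apply Complex.ext
      · simpa using h2
      · simp; ring
  rw [edist_dist, Real.dist_eq]
  exact ENNReal.ofReal_le_ofReal (abs_le.mpr ⟨by linarith [key x x' hx hx'], key x' x hx' hx⟩)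

/-- The singularity is integrable because `s < 1`. At distance at least one the integrand is at most
`1`, and the remaining piece is translation invariant, so the bound is uniform in `y₀`. -/
theorem lintegral_interval_singular_le {s : ℝ} (hs0 : 0 ≤ s) (hs : s < 1) (R : ℝ) :
    ∃ C : ENNReal, C ≠ ⊤ ∧ ∀ y₀ : ℝ,
      ∫⁻ y in Set.Ioo (-R) R, ‖y₀ - y‖ₑ⁻¹ ^ s ≤ C := by
  refine ⟨ENNReal.ofReal (R - -R) + ∫⁻ y in Set.Ioo (-1 : ℝ) 1, ‖y‖ₑ⁻¹ ^ s, ?_, fun y₀ => ?_⟩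
  · refine ENNReal.add_ne_top.2 ⟨ENNReal.ofReal_ne_top, ?_⟩
    have h1 : IntervalIntegrable (fun y : ℝ => |y| ^ (-s)) volume (-1) 1 := by
      have h := intervalIntegral.intervalIntegrable_rpow' (a := 0) (b := 1) (r := -s) (by linarith)
      have h0 : IntervalIntegrable (fun y : ℝ => |y| ^ (-s)) volume 0 1 := by
        refine h.congr fun y hy => ?_
        rw [Set.uIoc_of_le zero_le_one] at hy
        rw [abs_of_pos hy.1]
      refine IntervalIntegrable.trans (b := 0) ?_ h0
      have h2 := h0.comp_sub_left 0
      simp only [zero_sub, abs_neg, sub_zero] at h2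
      simpa using h2.symm
    rw [intervalIntegrable_iff_integrableOn_Ioo_of_le (by norm_num)] at h1
    have h2 := h1.hasFiniteIntegral.ne
    convert h2 using 1
    refine lintegral_congr_ae (ae_restrict_of_ae ?_)
    filter_upwards [compl_mem_ae_iff.mpr (measure_singleton (0 : ℝ))] with y hy
    have hy0 : 0 < |y| := abs_pos.mpr hy
    rw [Real.enorm_of_nonneg (r := |y| ^ (-s)) (by positivity), ← ENNReal.ofReal_rpow_of_pos hy0,
      ENNReal.rpow_neg, ENNReal.inv_rpow, ← Real.norm_eq_abs, ofReal_norm]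
  · have hpt : ∀ y : ℝ, ‖y₀ - y‖ₑ⁻¹ ^ s ≤
        1 + (Set.Ioo (-1 : ℝ) 1).indicator (fun x => ‖x‖ₑ⁻¹ ^ s) (y₀ - y) := by
      intro y
      by_cases hy : y₀ - y ∈ Set.Ioo (-1 : ℝ) 1
      · rw [Set.indicator_of_mem hy]; exact le_add_self
      · refine le_add_right ?_
        refine ENNReal.rpow_le_one ?_ hs0
        rw [ENNReal.inv_le_one, ← ofReal_norm, ← ENNReal.ofReal_one]
        refine ENNReal.ofReal_le_ofReal ?_
        rw [Real.norm_eq_abs]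
        by_contra h
        exact hy (abs_lt.1 (not_le.1 h))
    calc ∫⁻ y in Set.Ioo (-R) R, ‖y₀ - y‖ₑ⁻¹ ^ s
        ≤ ∫⁻ y in Set.Ioo (-R) R,
            (1 + (Set.Ioo (-1 : ℝ) 1).indicator (fun x => ‖x‖ₑ⁻¹ ^ s) (y₀ - y)) :=
          lintegral_mono hpt
      _ = ENNReal.ofReal (R - -R) + ∫⁻ y in Set.Ioo (-R) R,
            (Set.Ioo (-1 : ℝ) 1).indicator (fun x => ‖x‖ₑ⁻¹ ^ s) (y₀ - y) := by
          rw [lintegral_add_left measurable_const]; simp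
      _ ≤ ENNReal.ofReal (R - -R) + ∫⁻ y,
            (Set.Ioo (-1 : ℝ) 1).indicator (fun x => ‖x‖ₑ⁻¹ ^ s) (y₀ - y) := by
          gcongr; exact Measure.restrict_le_self
      _ = _ := by
          rw [lintegral_sub_left_eq_self
            ((Set.Ioo (-1 : ℝ) 1).indicator fun x => ‖x‖ₑ⁻¹ ^ s) y₀,
            lintegral_indicator measurableSet_Ioo]

/-- Replacing `|x - v|` by `|Im (x - v)|` only increases the integrand and makes it constant on
horizontal slices, each of length at most `τ`. A one-dimensional singular integral in the height
remains, which is why `s < 1` is needed. -/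
theorem lintegral_exitStrip_ofReal_le {s : ℝ} (hs0 : 0 ≤ s) (hs : s < 1) (R : ℝ) :
    ∃ C : ENNReal, C ≠ ⊤ ∧ ∀ Ω : Set ℂ, IsOpen Ω → Convex ℝ Ω → Ω ⊆ Metric.ball 0 R →
      ∀ τ : ℝ, 0 < τ → ∀ x : ℂ,
        ∫⁻ v in exitStrip Ω τ, ‖x - v‖ₑ⁻¹ ^ s ≤ C * ENNReal.ofReal τ := by
  obtain ⟨C, hC, hCb⟩ := lintegral_interval_singular_le hs0 hs R
  refine ⟨C, hC, fun Ω hΩ hc hR τ hτ x => ?_⟩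
  have hS := measurableSet_exitStrip hΩ (τ : ℂ)
  have hpt : ∀ v : ℂ, (exitStrip Ω τ).indicator (fun v => ‖x - v‖ₑ⁻¹ ^ s) v ≤
      (exitStrip Ω τ).indicator 1 v *
        (Set.Ioo (-R) R).indicator (fun y => ‖x.im - y‖ₑ⁻¹ ^ s) v.im := by
    intro v
    by_cases hv : v ∈ exitStrip Ω τ
    · have him : v.im ∈ Set.Ioo (-R) R := by
        have := hR hv.1
        rw [mem_ball_zero_iff] at this
        exact abs_lt.1 ((Complex.abs_im_le_norm v).trans_lt this)
      rw [Set.indicator_of_mem hv, Set.indicator_of_mem hv, Set.indicator_of_mem him,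
        Pi.one_apply, one_mul]
      gcongr
      rw [← ofReal_norm, ← ofReal_norm]
      refine ENNReal.ofReal_le_ofReal ?_
      simpa using Complex.abs_im_le_norm (x - v)
    · rw [Set.indicator_of_notMem hv]; exact zero_le
  have hm : Measurable fun q : ℝ × ℝ => (exitStrip Ω τ).indicator (1 : ℂ → ENNReal) ⟨q.1, q.2⟩ *
        (Set.Ioo (-R) R).indicator (fun y => ‖x.im - y‖ₑ⁻¹ ^ s) q.2 := by
    refine Measurable.mul ?_ ?_
    · exact (measurable_one.indicator hS).comp Complex.measurableEquivRealProd.symm.measurable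
    · exact (Measurable.indicator (f := fun y : ℝ => ‖x.im - y‖ₑ⁻¹ ^ s) (by fun_prop)
        measurableSet_Ioo).comp measurable_snd
  calc ∫⁻ v in exitStrip Ω τ, ‖x - v‖ₑ⁻¹ ^ s
      = ∫⁻ v, (exitStrip Ω τ).indicator (fun v => ‖x - v‖ₑ⁻¹ ^ s) v := by
        rw [lintegral_indicator hS]
    _ ≤ ∫⁻ v : ℂ, (exitStrip Ω τ).indicator 1 v *
        (Set.Ioo (-R) R).indicator (fun y => ‖x.im - y‖ₑ⁻¹ ^ s) v.im := lintegral_mono hpt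
    _ = ∫⁻ q : ℝ × ℝ, (exitStrip Ω τ).indicator (1 : ℂ → ENNReal) ⟨q.1, q.2⟩ *
        (Set.Ioo (-R) R).indicator (fun y => ‖x.im - y‖ₑ⁻¹ ^ s) q.2 := by
        rw [← Complex.volume_preserving_equiv_real_prod.symm.lintegral_comp_emb
          (MeasurableEquiv.measurableEmbedding _)]
        rfl
    _ = ∫⁻ y : ℝ, ∫⁻ t : ℝ, (exitStrip Ω τ).indicator (1 : ℂ → ENNReal) ⟨t, y⟩ *
        (Set.Ioo (-R) R).indicator (fun y => ‖x.im - y‖ₑ⁻¹ ^ s) y := by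
        rw [Measure.volume_eq_prod, lintegral_prod_symm' _ hm]
    _ ≤ ∫⁻ y : ℝ, ENNReal.ofReal τ *
        (Set.Ioo (-R) R).indicator (fun y => ‖x.im - y‖ₑ⁻¹ ^ s) y := by
        refine lintegral_mono fun y => ?_
        have hslice : Measurable fun t : ℝ => (⟨t, y⟩ : ℂ) :=
          Complex.measurableEquivRealProd.symm.measurable.comp
            (measurable_id.prodMk measurable_const)
        have hm1 : Measurable fun t : ℝ => (exitStrip Ω τ).indicator (1 : ℂ → ENNReal) ⟨t, y⟩ :=
          (measurable_one.indicator hS).comp hslice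
        rw [lintegral_mul_const _ hm1]
        gcongr
        exact le_trans (le_of_eq (lintegral_indicator_one (hslice hS)))
          (volume_slice_exitStrip_le hc hτ y)
    _ ≤ C * ENNReal.ofReal τ := by
        rw [lintegral_const_mul _ (Measurable.indicator (by fun_prop) measurableSet_Ioo),
          lintegral_indicator measurableSet_Ioo, mul_comm]
        gcongr
        exact hCb _

/-- The strip along the boundary of a bounded convex set swept by a translation by `θ` has
thickness `‖θ‖`, also with respect to singular weights of order less than one. -/
theorem lintegral_exitStrip_le {s : ℝ} (hs0 : 0 ≤ s) (hs : s < 1) {Ω : Set ℂ} (hΩ : IsOpen Ω)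
    (hc : Convex ℝ Ω) {R : ℝ} (hR : Ω ⊆ Metric.ball 0 R) :
    ∃ C : ENNReal, C ≠ ⊤ ∧ ∀ θ x : ℂ,
      ∫⁻ v in exitStrip Ω θ, ‖x - v‖ₑ⁻¹ ^ s ≤ C * ‖θ‖ₑ := by
  obtain ⟨C, hC, hCb⟩ := lintegral_exitStrip_ofReal_le hs0 hs R
  refine ⟨C, hC, fun θ x => ?_⟩
  rcases eq_or_ne θ 0 with rfl | hθ
  · have : exitStrip Ω 0 = ∅ := by ext v; simp [exitStrip]
    simp [this]
  have hn : 0 < ‖θ‖ := norm_pos_iff.2 hθ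
  have hnC : (‖θ‖ : ℂ) ≠ 0 := by exact_mod_cast hn.ne'
  -- A rotation makes the translation real and positive. The constant for real `τ` depends only on
  -- `s` and `R`, so it survives the rotation of `Ω`.
  obtain ⟨c, hcθ⟩ : ∃ c : Circle, (c : ℂ) * ‖θ‖ = θ :=
    ⟨⟨θ / ‖θ‖, by simp [Submonoid.unitSphere, hn.ne']⟩, by
      change θ / ‖θ‖ * ‖θ‖ = θ
      field_simp⟩
  have hmp := (rotation c).measurePreserving
  have hpre : (rotation c) ⁻¹' exitStrip Ω θ = exitStrip ((rotation c) ⁻¹' Ω) (‖θ‖ : ℝ) := by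
    ext v
    simp only [exitStrip, Set.mem_preimage, Set.mem_ofPred_eq, rotation_apply, mul_add, hcθ]
  have hb := hCb ((rotation c) ⁻¹' Ω) (hΩ.preimage (rotation c).continuous)
    (hc.linear_preimage ((rotation c).toLinearEquiv : ℂ →ₗ[ℝ] ℂ)) (fun v hv => by
      have := hR hv
      rw [mem_ball_zero_iff] at this ⊢
      rwa [LinearIsometryEquiv.norm_map] at this) ‖θ‖ hn ((rotation c).symm x)
  rw [ofReal_norm] at hb
  refine le_trans (le_of_eq ?_) hb
  rw [← hpre, ← hmp.setLIntegral_comp_preimage (measurableSet_exitStrip hΩ θ) (by fun_prop)]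
  refine lintegral_congr fun v => ?_
  congr 2
  rw [← (rotation c).enorm_map ((rotation c).symm x - v), map_sub,
    LinearIsometryEquiv.apply_symm_apply]

/-! ### Schur test and Newton potentials -/

/-- The Schur test, for positive kernels and with two majorants. -/
theorem lintegral_rpow_le_of_schur {X Y : Type*} [MeasurableSpace X] [MeasurableSpace Y]
    {μ : Measure X} {ν : Measure Y} [SFinite μ] [SFinite ν] {p q : ℝ} (hpq : p.HolderConjugate q)
    {k k₁ k₂ : X → Y → ENNReal} (hk₁ : Measurable (Function.uncurry k₁))
    (hk₂ : Measurable (Function.uncurry k₂))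
    (hk : ∀ x, ∀ᵐ y ∂ν, k x y ≤ k₁ x y ^ (1 / q) * k₂ x y ^ (1 / p)) {A B : ENNReal}
    (hA : ∀ x, ∫⁻ y, k₁ x y ∂ν ≤ A) (hB : ∀ᵐ y ∂ν, ∫⁻ x, k₂ x y ∂μ ≤ B)
    {f : Y → ENNReal} (hf : Measurable f) :
    ∫⁻ x, (∫⁻ y, k x y * f y ∂ν) ^ p ∂μ ≤ A ^ (p - 1) * B * ∫⁻ y, f y ^ p ∂ν := by
  have hp := hpq.pos
  have hq := hpq.symm.pos
  have hpt : ∀ x, (∫⁻ y, k x y * f y ∂ν) ^ p ≤ A ^ (p - 1) * ∫⁻ y, k₂ x y * f y ^ p ∂ν := by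
    intro x
    have m₁ : Measurable (k₁ x) := hk₁.comp measurable_prodMk_left
    have m₂ : Measurable (k₂ x) := hk₂.comp measurable_prodMk_left
    have h1 : ∫⁻ y, k x y * f y ∂ν ≤
        A ^ (1 / q) * (∫⁻ y, k₂ x y * f y ^ p ∂ν) ^ (1 / p) := by
      calc ∫⁻ y, k x y * f y ∂ν
          ≤ ∫⁻ y, ((fun y => k₁ x y ^ (1 / q)) * fun y => k₂ x y ^ (1 / p) * f y) y ∂ν := by
            refine lintegral_mono_ae ?_
            filter_upwards [hk x] with y hy
            rw [Pi.mul_apply, ← mul_assoc]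
            gcongr
        _ ≤ (∫⁻ y, (k₁ x y ^ (1 / q)) ^ q ∂ν) ^ (1 / q) *
            (∫⁻ y, (k₂ x y ^ (1 / p) * f y) ^ p ∂ν) ^ (1 / p) :=
            ENNReal.lintegral_mul_le_Lp_mul_Lq ν hpq.symm (m₁.pow_const _).aemeasurable
              ((m₂.pow_const _).mul hf).aemeasurable
        _ ≤ _ := by
            simp_rw [ENNReal.mul_rpow_of_nonneg _ _ hp.le, ← ENNReal.rpow_mul,
              one_div_mul_cancel hp.ne', one_div_mul_cancel hq.ne', ENNReal.rpow_one]
            gcongr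
            exact hA x
    calc (∫⁻ y, k x y * f y ∂ν) ^ p
        ≤ (A ^ (1 / q) * (∫⁻ y, k₂ x y * f y ^ p ∂ν) ^ (1 / p)) ^ p := by gcongr
      _ = A ^ (p - 1) * ∫⁻ y, k₂ x y * f y ^ p ∂ν := by
          rw [ENNReal.mul_rpow_of_nonneg _ _ hp.le, ← ENNReal.rpow_mul, ← ENNReal.rpow_mul,
            one_div_mul_cancel hp.ne', ENNReal.rpow_one, one_div_mul_eq_div, hpq.div_conj_eq_sub_one]
  have hm : Measurable (Function.uncurry fun x y => k₂ x y * f y ^ p) :=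
    hk₂.mul ((hf.pow_const p).comp measurable_snd)
  calc ∫⁻ x, (∫⁻ y, k x y * f y ∂ν) ^ p ∂μ
      ≤ ∫⁻ x, A ^ (p - 1) * ∫⁻ y, k₂ x y * f y ^ p ∂ν ∂μ := lintegral_mono hpt
    _ = A ^ (p - 1) * ∫⁻ x, ∫⁻ y, k₂ x y * f y ^ p ∂ν ∂μ :=
        lintegral_const_mul _ hm.lintegral_prod_right'
    _ = A ^ (p - 1) * ∫⁻ y, ∫⁻ x, k₂ x y * f y ^ p ∂μ ∂ν := by
        rw [lintegral_lintegral_swap hm.aemeasurable]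
    _ ≤ A ^ (p - 1) * ∫⁻ y, B * f y ^ p ∂ν := by
        gcongr A ^ (p - 1) * ?_
        refine lintegral_mono_ae ?_
        filter_upwards [hB] with y hy
        have m₂ : Measurable fun x => k₂ x y := hk₂.comp measurable_prodMk_right
        rw [lintegral_mul_const _ m₂]
        gcongr
    _ = A ^ (p - 1) * B * ∫⁻ y, f y ^ p ∂ν := by
        rw [lintegral_const_mul _ (hf.pow_const p), mul_assoc]

theorem lintegral_enorm_inv_rpow_le {s : ℝ} (hs0 : 0 ≤ s) (hs : s < 2) {Ω : Set ℂ}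
    (hΩ : volume Ω ≠ ⊤) :
    ∃ C : ENNReal, C ≠ ⊤ ∧ ∀ x : ℂ, ∫⁻ v in Ω, ‖x - v‖ₑ⁻¹ ^ s ≤ C := by
  -- The decay exponent `3` serves every `s ≥ 0`. On the unit disc its weight is at least `2⁻³`,
  -- which the factor `2 ^ 3` undoes; outside, the kernel is at most `1`.
  have hM := lintegral_radial_ne_top (a := 3) hs (by linarith)
  set M := ∫⁻ x : ℂ, (1 + ‖x‖ₑ) ^ (-(3 : ℝ)) * ‖x‖ₑ⁻¹ ^ s with hMdef
  refine ⟨volume Ω + 2 ^ (3 : ℝ) * M, ENNReal.add_ne_top.2 ⟨hΩ, ENNReal.mul_ne_top (by simp) hM⟩,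
    fun x => ?_⟩
  have hpt : ∀ y : ℂ, ‖y‖ₑ⁻¹ ^ s ≤
      1 + 2 ^ (3 : ℝ) * ((1 + ‖y‖ₑ) ^ (-(3 : ℝ)) * ‖y‖ₑ⁻¹ ^ s) := by
    intro y
    rcases le_total ‖y‖ₑ 1 with hy | hy
    · refine le_add_left ?_
      rw [← mul_assoc]
      refine le_mul_of_one_le_left' ?_
      have h2 : 1 + ‖y‖ₑ ≤ 2 := by
        calc 1 + ‖y‖ₑ ≤ 1 + 1 := by gcongr
          _ = 2 := one_add_one_eq_two
      calc (1 : ENNReal) = 2 ^ (3 : ℝ) * 2 ^ (-(3 : ℝ)) := by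
            rw [← ENNReal.rpow_add _ _ (by simp) (by simp)]; simp
        _ ≤ _ := by
            gcongr 2 ^ (3 : ℝ) * ?_
            rw [ENNReal.rpow_neg, ENNReal.rpow_neg, ENNReal.inv_le_inv]
            gcongr
    · refine le_add_right (ENNReal.rpow_le_one ?_ hs0)
      rwa [ENNReal.inv_le_one]
  calc ∫⁻ v in Ω, ‖x - v‖ₑ⁻¹ ^ s
      ≤ ∫⁻ v in Ω, (1 + 2 ^ (3 : ℝ) * ((1 + ‖x - v‖ₑ) ^ (-(3 : ℝ)) * ‖x - v‖ₑ⁻¹ ^ s)) :=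
        lintegral_mono fun v => hpt _
    _ = volume Ω + ∫⁻ v in Ω, 2 ^ (3 : ℝ) * ((1 + ‖x - v‖ₑ) ^ (-(3 : ℝ)) * ‖x - v‖ₑ⁻¹ ^ s) := by
        rw [lintegral_add_left measurable_const]; simp
    _ ≤ volume Ω + ∫⁻ v, 2 ^ (3 : ℝ) * ((1 + ‖x - v‖ₑ) ^ (-(3 : ℝ)) * ‖x - v‖ₑ⁻¹ ^ s) := by
        gcongr; exact Measure.restrict_le_self
    _ = _ := by
        rw [lintegral_sub_left_eq_self
          (fun y : ℂ => 2 ^ (3 : ℝ) * ((1 + ‖y‖ₑ) ^ (-(3 : ℝ)) * ‖y‖ₑ⁻¹ ^ s)) x,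
          lintegral_const_mul _ (by fun_prop)]

/-- The operator with kernel `|v - w|⁻¹`, from `L^p(Ω)` to `L^p` of a thin set. -/
theorem lintegral_newton_rpow_thin_le {p s : ℝ} (hp : 1 < p) (hs0 : 0 ≤ s) (hs1 : s < 1)
    (hsp : 2 - p < s) {Ω : Set ℂ} (hΩ : volume Ω ≠ ⊤) :
    ∃ C : ENNReal, C ≠ ⊤ ∧ ∀ (E : Set ℂ) (δ : ENNReal),
      (∀ x : ℂ, ∫⁻ v in E, ‖x - v‖ₑ⁻¹ ^ s ≤ δ) → ∀ f : ℂ → ENNReal, Measurable f →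
        ∫⁻ v in E, (∫⁻ w in Ω, ‖v - w‖ₑ⁻¹ * f w) ^ p ≤ C * δ * ∫⁻ w in Ω, f w ^ p := by
  have hp1 : 0 < p - 1 := by linarith
  -- The Schur splitting puts exponent `s` on the integral over the thin set; homogeneity forces `(p
  -- - s) / (p - 1)` on the integral over `Ω`, which is below `2` exactly when `2 - p < s`.
  obtain ⟨C, hC, hCb⟩ := lintegral_enorm_inv_rpow_le (s := (p - s) / (p - 1))
    (by apply div_nonneg <;> linarith) (by rw [div_lt_iff₀ hp1]; linarith) hΩ
  refine ⟨C ^ (p - 1), ENNReal.rpow_ne_top_of_nonneg hp1.le hC, fun E δ hE f hf => ?_⟩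
  have hpq : p.HolderConjugate (p / (p - 1)) := Real.HolderConjugate.conjExponent hp
  refine lintegral_rpow_le_of_schur hpq (k₁ := fun v w => ‖v - w‖ₑ⁻¹ ^ ((p - s) / (p - 1)))
    (k₂ := fun v w => ‖v - w‖ₑ⁻¹ ^ s) (by fun_prop) (by fun_prop) ?_ hCb ?_ hf
  · refine fun v => .of_forall fun w => ?_
    rw [← ENNReal.rpow_mul, ← ENNReal.rpow_mul, ← ENNReal.rpow_add_of_nonneg]
    · refine le_of_eq ?_
      have : (p - s) / (p - 1) * (1 / (p / (p - 1))) + s * (1 / p) = 1 := by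
        have : p ≠ 0 := by linarith
        field_simp
        ring
      rw [this, ENNReal.rpow_one]
    · have : 0 ≤ p - s := by linarith
      positivity
    · positivity
  · refine .of_forall fun w => ?_
    simp_rw [enorm_sub_rev _ w]
    exact hE w

theorem one_add_enorm_le_mul {R : ℝ} {v z : ℂ} (hv : v ∈ Metric.ball (0 : ℂ) R) :
    1 + ‖z - v‖ₑ ≤ (1 + ENNReal.ofReal R) * (1 + ‖z‖ₑ) := by
  have hv' : ‖v‖ₑ ≤ ENNReal.ofReal R := by
    rw [← ofReal_norm]
    exact ENNReal.ofReal_le_ofReal (mem_ball_zero_iff.1 hv).le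
  calc 1 + ‖z - v‖ₑ ≤ 1 + (‖z‖ₑ + ‖v‖ₑ) := by gcongr; exact enorm_sub_le
    _ ≤ 1 + (‖z‖ₑ + ENNReal.ofReal R) := by gcongr
    _ ≤ 1 + (‖z‖ₑ + ENNReal.ofReal R) + ENNReal.ofReal R * ‖z‖ₑ := le_self_add
    _ = _ := by ring

/-- The operator with kernel `|z - v|⁻¹`, from `L^p` of a thin bounded set to a weighted `L^p(ℂ)`. -/
theorem lintegral_newton_rpow_weight_le {p s ε : ℝ} (hp : 1 < p) (hs0 : 0 ≤ s)
    (hsp : p - (p - 1) * s < 2) (hsp0 : 0 ≤ p - (p - 1) * s) (hε : 0 ≤ ε) (hpε : 2 < p * ε + p)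
    (R : ℝ) :
    ∃ C : ENNReal, C ≠ ⊤ ∧ ∀ (E : Set ℂ) (δ : ENNReal), MeasurableSet E → E ⊆ Metric.ball 0 R →
      volume E ≤ δ → (∀ x : ℂ, ∫⁻ v in E, ‖x - v‖ₑ⁻¹ ^ s ≤ δ) →
      ∀ f : ℂ → ENNReal, Measurable f →
        ∫⁻ z, ((1 + ‖z‖ₑ) ^ (-ε) * ∫⁻ v in E, ‖z - v‖ₑ⁻¹ * f v) ^ p ≤
          C * δ ^ (p - 1) * ∫⁻ v in E, f v ^ p := by
  have hp1 : 0 < p - 1 := by linarith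
  have hp0 : 0 < p := by linarith
  -- The factor `(1 + ‖z‖) ^ s` is moved into the first majorant to balance the decay of `‖z - v‖⁻¹
  -- ^ s`. The second then has singularity `t < 2` and total decay `a + t = p * ε + p > 2`.
  obtain ⟨a, ha⟩ : ∃ a, a = p * ε + (p - 1) * s := ⟨_, rfl⟩
  obtain ⟨t, ht⟩ : ∃ t, t = p - (p - 1) * s := ⟨_, rfl⟩
  have ha0 : 0 ≤ a := by rw [ha]; positivity
  have hM := lintegral_radial_ne_top (a := a) (s := t) (by linarith) (by linarith)
  set M := ∫⁻ x : ℂ, (1 + ‖x‖ₑ) ^ (-a) * ‖x‖ₑ⁻¹ ^ t with hMdef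
  set ρ : ENNReal := 1 + ENNReal.ofReal R with hρ
  have hρtop : ρ ≠ ⊤ := by simp [hρ]
  have hρ0 : ρ ≠ 0 := by simp [hρ]
  refine ⟨(ρ ^ s * 2 ^ s * 2) ^ (p - 1) * (ρ ^ a * M), ?_, fun E δ hEm hER hvol hE f hf => ?_⟩
  · refine ENNReal.mul_ne_top (ENNReal.rpow_ne_top_of_nonneg hp1.le
      (ENNReal.mul_ne_top (ENNReal.mul_ne_top ?_ ?_) (by simp))) (ENNReal.mul_ne_top ?_ hM)
    · exact ENNReal.rpow_ne_top_of_nonneg hs0 hρtop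
    · exact ENNReal.rpow_ne_top_of_nonneg hs0 (by simp)
    · exact ENNReal.rpow_ne_top_of_nonneg ha0 hρtop
  have hpq : p.HolderConjugate (p / (p - 1)) := Real.HolderConjugate.conjExponent hp
  have hω0 : ∀ z : ℂ, 1 + ‖z‖ₑ ≠ 0 := fun z => by simp
  have hωtop : ∀ z : ℂ, 1 + ‖z‖ₑ ≠ ⊤ := fun z => by simp
  have hmain := lintegral_rpow_le_of_schur (μ := (volume : Measure ℂ)) (ν := volume.restrict E) hpq
    (k := fun z v => (1 + ‖z‖ₑ) ^ (-ε) * ‖z - v‖ₑ⁻¹)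
    (k₁ := fun z v => (1 + ‖z‖ₑ) ^ s * ‖z - v‖ₑ⁻¹ ^ s)
    (k₂ := fun z v => (1 + ‖z‖ₑ) ^ (-a) * ‖z - v‖ₑ⁻¹ ^ t) (by fun_prop) (by fun_prop)
    (A := ρ ^ s * 2 ^ s * 2 * δ) (B := ρ ^ a * M) ?_ ?_ ?_ hf
  · calc ∫⁻ z, ((1 + ‖z‖ₑ) ^ (-ε) * ∫⁻ v in E, ‖z - v‖ₑ⁻¹ * f v) ^ p
        = ∫⁻ z, (∫⁻ v in E, (1 + ‖z‖ₑ) ^ (-ε) * ‖z - v‖ₑ⁻¹ * f v) ^ p := by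
          refine lintegral_congr fun z => ?_
          rw [← lintegral_const_mul _ (by fun_prop)]
          simp_rw [mul_assoc]
      _ ≤ _ := hmain
      _ = _ := by
          rw [ENNReal.mul_rpow_of_nonneg _ δ hp1.le]
          ring
  · refine fun z => .of_forall fun v => le_of_eq ?_
    have hq0 : 0 ≤ 1 / (p / (p - 1)) := by positivity
    rw [ENNReal.mul_rpow_of_nonneg _ _ hq0, ENNReal.mul_rpow_of_nonneg _ _ (by positivity),
      mul_mul_mul_comm, ← ENNReal.rpow_mul, ← ENNReal.rpow_mul, ← ENNReal.rpow_mul,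
      ← ENNReal.rpow_mul, ← ENNReal.rpow_add _ _ (hω0 z) (hωtop z),
      ← ENNReal.rpow_add_of_nonneg _ _ (by positivity) (by rw [ht]; positivity)]
    congr 1
    · congr 1; rw [ha]; field_simp; ring
    · have : s * (1 / (p / (p - 1))) + t * (1 / p) = 1 := by rw [ht]; field_simp; ring
      rw [this, ENNReal.rpow_one]
  · intro z
    -- Near `v` the weight is bounded and the singular integral over `E` is at most `δ`; far from
    -- `v` weight and kernel cancel and only the volume of `E` remains, also at most `δ`.
    have hpt : ∀ v ∈ E, (1 + ‖z‖ₑ) ^ s * ‖z - v‖ₑ⁻¹ ^ s ≤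
        ρ ^ s * 2 ^ s * (1 + ‖z - v‖ₑ⁻¹ ^ s) := by
      intro v hv
      have h1 : 1 + ‖z‖ₑ ≤ ρ * (1 + ‖z - v‖ₑ) := by
        simpa using one_add_enorm_le_mul (z := z - v) (v := -v) (by simpa using hER hv)
      rw [← ENNReal.mul_rpow_of_nonneg _ _ hs0]
      rcases le_total ‖z - v‖ₑ 1 with h | h
      · calc ((1 + ‖z‖ₑ) * ‖z - v‖ₑ⁻¹) ^ s ≤ (ρ * (1 + 1) * ‖z - v‖ₑ⁻¹) ^ s := by
              gcongr; exact h1.trans (by gcongr)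
          _ = ρ ^ s * 2 ^ s * ‖z - v‖ₑ⁻¹ ^ s := by
              rw [one_add_one_eq_two, ENNReal.mul_rpow_of_nonneg _ _ hs0,
                ENNReal.mul_rpow_of_nonneg _ _ hs0]
          _ ≤ _ := by gcongr; exact le_add_self
      · have h0 : ‖z - v‖ₑ ≠ 0 := (lt_of_lt_of_le one_pos h).ne'
        calc ((1 + ‖z‖ₑ) * ‖z - v‖ₑ⁻¹) ^ s
            ≤ (ρ * (‖z - v‖ₑ + ‖z - v‖ₑ) * ‖z - v‖ₑ⁻¹) ^ s := by
              gcongr; exact h1.trans (by gcongr)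
          _ = (ρ * 2) ^ s := by
              rw [← two_mul, mul_assoc, mul_assoc, ENNReal.mul_inv_cancel h0 (by simp), mul_one]
          _ = ρ ^ s * 2 ^ s * 1 := by rw [ENNReal.mul_rpow_of_nonneg _ _ hs0, mul_one]
          _ ≤ _ := by gcongr; exact le_self_add
    calc ∫⁻ v in E, (1 + ‖z‖ₑ) ^ s * ‖z - v‖ₑ⁻¹ ^ s
        ≤ ∫⁻ v in E, ρ ^ s * 2 ^ s * (1 + ‖z - v‖ₑ⁻¹ ^ s) := setLIntegral_mono' hEm hpt
      _ = ρ ^ s * 2 ^ s * (volume E + ∫⁻ v in E, ‖z - v‖ₑ⁻¹ ^ s) := by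
          rw [lintegral_const_mul _ (by fun_prop), lintegral_add_left measurable_const]
          simp
      _ ≤ ρ ^ s * 2 ^ s * (δ + δ) := by gcongr; exact hE z
      _ = _ := by ring
  · filter_upwards [ae_restrict_mem hEm] with v hv
    calc ∫⁻ z, (1 + ‖z‖ₑ) ^ (-a) * ‖z - v‖ₑ⁻¹ ^ t
        ≤ ∫⁻ z, ρ ^ a * ((1 + ‖z - v‖ₑ) ^ (-a) * ‖z - v‖ₑ⁻¹ ^ t) := by
          refine lintegral_mono fun z => ?_
          rw [← mul_assoc]
          gcongr ?_ * _
          have h := one_add_enorm_le_mul (z := z) (hER hv)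
          rw [ENNReal.rpow_neg, ENNReal.rpow_neg, ← div_eq_mul_inv, ENNReal.le_div_iff_mul_le
            (.inl (by simp [ENNReal.rpow_eq_zero_iff])) (.inl (ENNReal.rpow_ne_top_of_nonneg ha0
            (hωtop _))), mul_comm, ← div_eq_mul_inv]
          refine ENNReal.div_le_of_le_mul ?_
          rw [← ENNReal.mul_rpow_of_nonneg _ _ ha0]
          gcongr
      _ = ρ ^ a * M := by
          rw [lintegral_sub_right_eq_self
            (fun y : ℂ => ρ ^ a * ((1 + ‖y‖ₑ) ^ (-a) * ‖y‖ₑ⁻¹ ^ t)) v,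
            lintegral_const_mul _ (by fun_prop)]

/-! ### The bump kernel and the choice of exponent -/

/-- An integrable kernel of total mass comparable to `τ`, equivalent to `min (|x|⁻¹, τ²|x|⁻³)`. -/
noncomputable def bumpKernel (τ : ℝ) (x : ℂ) : ENNReal :=
  ENNReal.ofReal (τ ^ 2 / (τ ^ 2 + ‖x‖ ^ 2)) * ‖x‖ₑ⁻¹

@[fun_prop]
theorem measurable_bumpKernel (τ : ℝ) : Measurable (bumpKernel τ) := by
  unfold bumpKernel; fun_prop

/-- Under `x ↦ τ x` the kernel scales by `τ⁻¹` and area by `τ²`, so the mass is `τ` times that at `τ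
= 1`, finite because the kernel decays like `|x|⁻³`. -/
theorem lintegral_bumpKernel_le :
    ∃ C : ENNReal, C ≠ ⊤ ∧ ∀ τ : ℝ, 0 < τ → ∫⁻ x, bumpKernel τ x ≤ C * ENNReal.ofReal τ := by
  have hM := lintegral_radial_ne_top (a := 2) (s := 1) (by norm_num) (by norm_num)
  set M := ∫⁻ x : ℂ, (1 + ‖x‖ₑ) ^ (-(2 : ℝ)) * ‖x‖ₑ⁻¹ ^ (1 : ℝ) with hMdef
  have h1 : ∫⁻ x, bumpKernel 1 x ≤ 2 * M := by
    rw [hMdef, ← lintegral_const_mul _ (by fun_prop)]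
    refine lintegral_mono fun x => ?_
    rw [bumpKernel, ENNReal.rpow_one, ← mul_assoc]
    gcongr ?_ * _
    rw [← ofReal_norm, ← ENNReal.ofReal_one, ← ENNReal.ofReal_add zero_le_one (norm_nonneg x),
      ENNReal.ofReal_rpow_of_pos (by positivity), show (2 : ENNReal) = ENNReal.ofReal 2 by simp,
      ← ENNReal.ofReal_mul zero_le_two]
    refine ENNReal.ofReal_le_ofReal ?_
    rw [Real.rpow_neg (by positivity), Real.rpow_two, ← div_eq_mul_inv,
      div_le_div_iff₀ (by positivity) (by positivity)]
    nlinarith [sq_nonneg (‖x‖ - 1)]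
  refine ⟨2 * M, ENNReal.mul_ne_top (by simp) hM, fun τ hτ => ?_⟩
  have hτ0 : ENNReal.ofReal τ ≠ 0 := by simpa using hτ
  have hmap := Measure.map_addHaar_smul (volume : Measure ℂ) hτ.ne'
  have hsc : ∀ x : ℂ, bumpKernel τ (τ • x) = (ENNReal.ofReal τ)⁻¹ * bumpKernel 1 x := by
    intro x
    rw [bumpKernel, bumpKernel, norm_smul, enorm_smul, Real.norm_of_nonneg hτ.le,
      Real.enorm_of_nonneg hτ.le, ENNReal.mul_inv (.inl hτ0) (.inl ENNReal.ofReal_ne_top),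
      mul_left_comm]
    congr 3
    field_simp
  have hI : ∫⁻ x, bumpKernel τ (τ • x) =
      ENNReal.ofReal |(τ ^ 2)⁻¹| * ∫⁻ x, bumpKernel τ x := by
    rw [← lintegral_map (f := bumpKernel τ) (g := fun x : ℂ => τ • x) (by fun_prop) (by fun_prop),
      hmap, lintegral_smul_measure, Complex.finrank_real_complex, smul_eq_mul]
  simp_rw [hsc] at hI
  rw [lintegral_const_mul _ (by fun_prop), abs_of_nonneg (by positivity),
    ENNReal.ofReal_inv_of_pos (by positivity), ENNReal.ofReal_pow hτ.le] at hI
  have hI2 : ∫⁻ x, bumpKernel τ x = ENNReal.ofReal τ * ∫⁻ x, bumpKernel 1 x := by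
    calc ∫⁻ x, bumpKernel τ x
        = ENNReal.ofReal τ ^ 2 * ((ENNReal.ofReal τ ^ 2)⁻¹ * ∫⁻ x, bumpKernel τ x) := by
          rw [← mul_assoc, ENNReal.mul_inv_cancel (pow_ne_zero 2 hτ0) (by simp), one_mul]
      _ = ENNReal.ofReal τ * (ENNReal.ofReal τ * (ENNReal.ofReal τ)⁻¹) *
            ∫⁻ x, bumpKernel 1 x := by rw [← hI]; ring
      _ = _ := by rw [ENNReal.mul_inv_cancel hτ0 ENNReal.ofReal_ne_top, mul_one]
  rw [hI2, mul_comm]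
  gcongr

/-- Young's inequality for convolution with an integrable kernel: the Schur test with both majorants
equal to the kernel. -/
theorem lintegral_bumpKernel_rpow_le {p : ℝ} (hp : 1 < p) :
    ∃ C : ENNReal, C ≠ ⊤ ∧ ∀ τ : ℝ, 0 < τ → ∀ (D : Set ℂ) (f : ℂ → ENNReal), Measurable f →
      ∫⁻ z, (∫⁻ v in D, bumpKernel τ (z - v) * f v) ^ p ≤
        C * ENNReal.ofReal τ ^ p * ∫⁻ v in D, f v ^ p := by
  obtain ⟨C, hC, hCb⟩ := lintegral_bumpKernel_le
  have hp0 : 0 < p := by linarith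
  refine ⟨C ^ p, ENNReal.rpow_ne_top_of_nonneg hp0.le hC, fun τ hτ D f hf => ?_⟩
  have hpq : p.HolderConjugate (p / (p - 1)) := Real.HolderConjugate.conjExponent hp
  have hm : Measurable (Function.uncurry fun z v : ℂ => bumpKernel τ (z - v)) := by fun_prop
  refine (lintegral_rpow_le_of_schur (μ := (volume : Measure ℂ)) (ν := volume.restrict D) hpq
    (k := fun z v => bumpKernel τ (z - v)) hm hm (A := C * ENNReal.ofReal τ)
    (B := C * ENNReal.ofReal τ) ?_ ?_ ?_ hf).trans_eq ?_
  · refine fun z => .of_forall fun v => le_of_eq ?_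
    have hq0 := hpq.symm.pos
    rw [← ENNReal.rpow_add_of_nonneg _ _ (by positivity) (by positivity), one_div, one_div,
      add_comm, hpq.inv_add_inv_eq_one, ENNReal.rpow_one]
  · intro z
    calc ∫⁻ v in D, bumpKernel τ (z - v) ≤ ∫⁻ v, bumpKernel τ (z - v) :=
          lintegral_mono' Measure.restrict_le_self le_rfl
      _ ≤ _ := by rw [lintegral_sub_left_eq_self]; exact hCb τ hτ
  · refine .of_forall fun v => ?_
    rw [lintegral_sub_right_eq_self]
    exact hCb τ hτ
  · congr 1
    rw [← ENNReal.mul_rpow_of_nonneg _ _ hp0.le]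
    nth_rw 2 [← ENNReal.rpow_one (C * ENNReal.ofReal τ)]
    rw [← ENNReal.rpow_add_of_nonneg _ _ (by linarith) zero_le_one, sub_add_cancel]

/-- At `s = 1` every condition except `s < 1` holds, the two involving `2` strictly since `p > 1`;
an `s` slightly below `1` therefore works. -/
theorem exists_schur_exponent {p : ℝ} (hp : 1 < p) :
    ∃ s : ℝ, 0 ≤ s ∧ s < 1 ∧ 2 - p < s ∧ p - (p - 1) * s < 2 ∧ 0 ≤ p - (p - 1) * s := by
  have h0 : 0 < p := by linarith
  have h1 : 0 < p - 1 := by linarith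
  have hd : 0 < (p - 1) / (2 * p ^ 2) := by positivity
  have hd1 : (p - 1) / (2 * p ^ 2) ≤ 1 := by
    rw [div_le_one (by positivity)]; nlinarith
  refine ⟨1 - (p - 1) / (2 * p ^ 2), by linarith, by linarith, ?_, ?_, ?_⟩
  · have : (p - 1) / (2 * p ^ 2) < p - 1 := by
      have h2 : 1 < 2 * p ^ 2 := by nlinarith
      exact div_lt_self h1 h2
    linarith
  · have : (p - 1) * ((p - 1) / (2 * p ^ 2)) < 1 := by
      rw [← mul_div_assoc, div_lt_one (by positivity)]; nlinarith
    linarith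
  · nlinarith [mul_pos h1 hd]

/-! ### Weighted `L^p` bound for the majorant -/

/-- The set of points of `Ω` moved out of `Ω` by the translation by `2 * η` or `-2 * η`. -/
def boundaryStrip (Ω : Set ℂ) (η : ℂ) : Set ℂ := exitStrip Ω (2 * η) ∪ exitStrip Ω (-(2 * η))

/-- The positive majorant of the composition `AB`: bump and Newton kernels in either order, and two
Newton kernels across the boundary strip. -/
noncomputable def majorant (Ω : Set ℂ) (η : ℂ) (U : ℂ → ENNReal) (z : ℂ) : ENNReal :=
  (∫⁻ v in Ω, bumpKernel ‖η‖ (z - v) * ∫⁻ w in Ω, ‖v - w‖ₑ⁻¹ * U w) +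
  (∫⁻ v in Ω, ‖z - v‖ₑ⁻¹ * ∫⁻ w in Ω, bumpKernel ‖η‖ (v - w) * U w) +
  ∫⁻ v in boundaryStrip Ω η, ‖z - v‖ₑ⁻¹ * ∫⁻ w in Ω, ‖v - w‖ₑ⁻¹ * U w

theorem measurableSet_boundaryStrip {Ω : Set ℂ} (hΩ : IsOpen Ω) (η : ℂ) :
    MeasurableSet (boundaryStrip Ω η) :=
  (measurableSet_exitStrip hΩ _).union (measurableSet_exitStrip hΩ _)

theorem boundaryStrip_subset (Ω : Set ℂ) (η : ℂ) : boundaryStrip Ω η ⊆ Ω :=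
  Set.union_subset (fun _ h => h.1) fun _ h => h.1

theorem lintegral_boundaryStrip_le {s : ℝ} (hs0 : 0 ≤ s) (hs : s < 1) {Ω : Set ℂ} (hΩ : IsOpen Ω)
    (hc : Convex ℝ Ω) {R : ℝ} (hR : Ω ⊆ Metric.ball 0 R) :
    ∃ C : ENNReal, C ≠ ⊤ ∧ ∀ η x : ℂ,
      ∫⁻ v in boundaryStrip Ω η, ‖x - v‖ₑ⁻¹ ^ s ≤ C * ‖η‖ₑ := by
  obtain ⟨C, hC, hCb⟩ := lintegral_exitStrip_le hs0 hs hΩ hc hR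
  refine ⟨4 * C, ENNReal.mul_ne_top (by simp) hC, fun η x => ?_⟩
  have h2 : ‖2 * η‖ₑ = 2 * ‖η‖ₑ := by
    rw [enorm_mul]
    congr 1
    rw [← ofReal_norm]; simp
  calc ∫⁻ v in boundaryStrip Ω η, ‖x - v‖ₑ⁻¹ ^ s
      ≤ (∫⁻ v in exitStrip Ω (2 * η), ‖x - v‖ₑ⁻¹ ^ s) +
          ∫⁻ v in exitStrip Ω (-(2 * η)), ‖x - v‖ₑ⁻¹ ^ s := lintegral_union_le _ _ _
    _ ≤ C * ‖2 * η‖ₑ + C * ‖-(2 * η)‖ₑ := add_le_add (hCb _ _) (hCb _ _)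
    _ = 4 * C * ‖η‖ₑ := by rw [enorm_neg, h2]; ring

theorem lintegral_newton_rpow_domain_le {p : ℝ} (hp : 1 < p) {Ω : Set ℂ} (hΩ : volume Ω ≠ ⊤) :
    ∃ C : ENNReal, C ≠ ⊤ ∧ ∀ f : ℂ → ENNReal, Measurable f →
      ∫⁻ v in Ω, (∫⁻ w in Ω, ‖v - w‖ₑ⁻¹ * f w) ^ p ≤ C * ∫⁻ w in Ω, f w ^ p := by
  obtain ⟨s, hs0, hs1, hsp, -, -⟩ := exists_schur_exponent hp
  obtain ⟨C, hC, hCb⟩ := lintegral_newton_rpow_thin_le hp hs0 hs1 hsp hΩ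
  obtain ⟨D, hD, hDb⟩ := lintegral_enorm_inv_rpow_le hs0 (by linarith) hΩ
  exact ⟨C * D, ENNReal.mul_ne_top hC hD, fun f hf => hCb Ω D hDb f hf⟩

theorem lintegral_newton_rpow_weight_domain_le {p ε : ℝ} (hp : 1 < p) (hε : 0 ≤ ε)
    (hpε : 2 < p * ε + p) {Ω : Set ℂ} (hm : MeasurableSet Ω) {R : ℝ} (hR : Ω ⊆ Metric.ball 0 R)
    (hΩ : volume Ω ≠ ⊤) :
    ∃ C : ENNReal, C ≠ ⊤ ∧ ∀ f : ℂ → ENNReal, Measurable f →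
      ∫⁻ z, ((1 + ‖z‖ₑ) ^ (-ε) * ∫⁻ v in Ω, ‖z - v‖ₑ⁻¹ * f v) ^ p ≤ C * ∫⁻ w in Ω, f w ^ p := by
  obtain ⟨s, hs0, hs1, -, hsp, hsp0⟩ := exists_schur_exponent hp
  obtain ⟨C, hC, hCb⟩ := lintegral_newton_rpow_weight_le hp hs0 hsp hsp0 hε hpε R
  obtain ⟨D, hD, hDb⟩ := lintegral_enorm_inv_rpow_le hs0 (by linarith) hΩ
  exact ⟨C * (volume Ω + D) ^ (p - 1),
    ENNReal.mul_ne_top hC (ENNReal.rpow_ne_top_of_nonneg (by linarith)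
      (ENNReal.add_ne_top.2 ⟨hΩ, hD⟩)),
    fun f hf => hCb Ω _ hm hR le_self_add (fun x => (hDb x).trans le_add_self) f hf⟩

theorem lintegral_majorant_rpow_le {p ε : ℝ} (hp : 1 < p) (hε : 0 ≤ ε) (hpε : 2 < p * ε + p)
    {Ω : Set ℂ} (hΩ : IsOpen Ω) (hc : Convex ℝ Ω) {R : ℝ} (hR : Ω ⊆ Metric.ball 0 R) :
    ∃ C : ENNReal, C ≠ ⊤ ∧ ∀ η : ℂ, η ≠ 0 → ∀ U : ℂ → ENNReal, Measurable U →
      ∫⁻ z, ((1 + ‖z‖ₑ) ^ (-ε) * majorant Ω η U z) ^ p ≤ C * ‖η‖ₑ ^ p * ∫⁻ w in Ω, U w ^ p := by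
  have hp0 : 0 < p := by linarith
  have hvol : volume Ω ≠ ⊤ := ((measure_mono hR).trans_lt measure_ball_lt_top).ne
  obtain ⟨s, hs0, hs1, hsp, hsp1, hsp0⟩ := exists_schur_exponent hp
  obtain ⟨C₁, hC₁, h₁⟩ := lintegral_newton_rpow_domain_le hp hvol
  obtain ⟨C₂, hC₂, h₂⟩ := lintegral_newton_rpow_weight_domain_le hp hε hpε hΩ.measurableSet hR hvol
  obtain ⟨C₃, hC₃, h₃⟩ := lintegral_newton_rpow_thin_le hp hs0 hs1 hsp hvol
  obtain ⟨C₄, hC₄, h₄⟩ := lintegral_newton_rpow_weight_le hp hs0 hsp1 hsp0 hε hpε R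
  obtain ⟨C₅, hC₅, h₅⟩ := lintegral_boundaryStrip_le hs0 hs1 hΩ hc hR
  -- Exponent zero: this is the bound on the area of the strip.
  obtain ⟨C₆, hC₆, h₆⟩ := lintegral_boundaryStrip_le le_rfl one_pos hΩ hc hR
  obtain ⟨C₇, hC₇, h₇⟩ := lintegral_bumpKernel_rpow_le hp
  set D := C₅ + C₆
  have hD : D ≠ ⊤ := ENNReal.add_ne_top.2 ⟨hC₅, hC₆⟩
  refine ⟨(2 ^ (p - 1)) * (2 ^ (p - 1) * (C₇ * C₁ + C₂ * C₇) + C₄ * C₃ * D ^ p), ?_,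
    fun η hη U hU => ?_⟩
  · have h2 : (2 : ENNReal) ^ (p - 1) ≠ ⊤ := ENNReal.rpow_ne_top_of_nonneg (by linarith) (by simp)
    have hDp : D ^ p ≠ ⊤ := ENNReal.rpow_ne_top_of_nonneg hp0.le hD
    finiteness
  have hτ : 0 < ‖η‖ := norm_pos_iff.2 hη
  set W : ℂ → ENNReal := fun z => (1 + ‖z‖ₑ) ^ (-ε)
  have hW1 : ∀ z, W z ≤ 1 := fun z => by
    simp only [W, ENNReal.rpow_neg, ENNReal.inv_le_one]
    rcases hε.eq_or_lt with rfl | h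
    · simp
    · exact ENNReal.one_le_rpow le_self_add h
  set J := ∫⁻ w in Ω, U w ^ p
  set N : ℂ → ENNReal := fun v => ∫⁻ w in Ω, ‖v - w‖ₑ⁻¹ * U w with hN
  set Q : ℂ → ENNReal := fun v => ∫⁻ w in Ω, bumpKernel ‖η‖ (v - w) * U w with hQ
  have hNm : Measurable N := Measurable.lintegral_prod_right' (f := fun q : ℂ × ℂ =>
    ‖q.1 - q.2‖ₑ⁻¹ * U q.2) (by fun_prop)
  have hQm : Measurable Q := Measurable.lintegral_prod_right' (f := fun q : ℂ × ℂ =>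
    bumpKernel ‖η‖ (q.1 - q.2) * U q.2) (by fun_prop)
  have e₁ : ∫⁻ z, (W z * ∫⁻ v in Ω, bumpKernel ‖η‖ (z - v) * N v) ^ p ≤
      C₇ * C₁ * (‖η‖ₑ ^ p * J) := by
    calc ∫⁻ z, (W z * ∫⁻ v in Ω, bumpKernel ‖η‖ (z - v) * N v) ^ p
        ≤ ∫⁻ z, (∫⁻ v in Ω, bumpKernel ‖η‖ (z - v) * N v) ^ p := by
          gcongr with z
          exact mul_le_of_le_one_left' (hW1 z)
      _ ≤ C₇ * ENNReal.ofReal ‖η‖ ^ p * ∫⁻ v in Ω, N v ^ p := h₇ _ hτ Ω N hNm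
      _ ≤ C₇ * ENNReal.ofReal ‖η‖ ^ p * (C₁ * J) := by gcongr; exact h₁ U hU
      _ = _ := by rw [ofReal_norm]; ring
  have e₂ : ∫⁻ z, (W z * ∫⁻ v in Ω, ‖z - v‖ₑ⁻¹ * Q v) ^ p ≤ C₂ * C₇ * (‖η‖ₑ ^ p * J) := by
    calc ∫⁻ z, (W z * ∫⁻ v in Ω, ‖z - v‖ₑ⁻¹ * Q v) ^ p
        ≤ C₂ * ∫⁻ v in Ω, Q v ^ p := h₂ Q hQm
      _ ≤ C₂ * ∫⁻ v, Q v ^ p := by gcongr; exact Measure.restrict_le_self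
      _ ≤ C₂ * (C₇ * ENNReal.ofReal ‖η‖ ^ p * J) := by gcongr; exact h₇ _ hτ Ω U hU
      _ = _ := by rw [ofReal_norm]; ring
  have e₃ : ∫⁻ z, (W z * ∫⁻ v in boundaryStrip Ω η, ‖z - v‖ₑ⁻¹ * N v) ^ p ≤
      C₄ * C₃ * D ^ p * (‖η‖ₑ ^ p * J) := by
    have hb : ∀ x : ℂ, ∫⁻ v in boundaryStrip Ω η, ‖x - v‖ₑ⁻¹ ^ s ≤ D * ‖η‖ₑ := fun x =>
      (h₅ η x).trans (by gcongr; exact le_self_add)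
    have hv : volume (boundaryStrip Ω η) ≤ D * ‖η‖ₑ := by
      refine le_trans (le_of_eq ?_) ((h₆ η 0).trans (by gcongr; exact le_add_self))
      simp
    calc ∫⁻ z, (W z * ∫⁻ v in boundaryStrip Ω η, ‖z - v‖ₑ⁻¹ * N v) ^ p
        ≤ C₄ * (D * ‖η‖ₑ) ^ (p - 1) * ∫⁻ v in boundaryStrip Ω η, N v ^ p :=
          h₄ _ _ (measurableSet_boundaryStrip hΩ η) ((boundaryStrip_subset Ω η).trans hR) hv hb N hNm
      _ ≤ C₄ * (D * ‖η‖ₑ) ^ (p - 1) * (C₃ * (D * ‖η‖ₑ) * J) := by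
          gcongr; exact h₃ _ _ hb U hU
      -- The gains `p - 1` (out of the strip) and `1` (into it) combine to the full power `p` of
      -- `‖η‖ₑ`.
      _ = C₄ * C₃ * ((D * ‖η‖ₑ) ^ (p - 1) * (D * ‖η‖ₑ) ^ (1 : ℝ)) * J := by
          rw [ENNReal.rpow_one]; ring
      _ = _ := by
          rw [← ENNReal.rpow_add_of_nonneg _ _ (by linarith) zero_le_one, sub_add_cancel,
            ENNReal.mul_rpow_of_nonneg _ _ hp0.le]
          ring
  set T₁ : ℂ → ENNReal := fun z => W z * ∫⁻ v in Ω, bumpKernel ‖η‖ (z - v) * N v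
  set T₂ : ℂ → ENNReal := fun z => W z * ∫⁻ v in Ω, ‖z - v‖ₑ⁻¹ * Q v
  set T₃ : ℂ → ENNReal := fun z => W z * ∫⁻ v in boundaryStrip Ω η, ‖z - v‖ₑ⁻¹ * N v
  have hWm : Measurable W := by fun_prop
  have mT₁ : Measurable T₁ := hWm.mul (Measurable.lintegral_prod_right' (f := fun q : ℂ × ℂ =>
    bumpKernel ‖η‖ (q.1 - q.2) * N q.2) (by fun_prop))
  have mT₂ : Measurable T₂ := hWm.mul (Measurable.lintegral_prod_right' (f := fun q : ℂ × ℂ =>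
    ‖q.1 - q.2‖ₑ⁻¹ * Q q.2) (by fun_prop))
  calc ∫⁻ z, (W z * majorant Ω η U z) ^ p
      = ∫⁻ z, (T₁ z + T₂ z + T₃ z) ^ p := by
        refine lintegral_congr fun z => ?_
        rw [majorant, mul_add, mul_add]
    _ ≤ ∫⁻ z, 2 ^ (p - 1) * (2 ^ (p - 1) * (T₁ z ^ p + T₂ z ^ p) + T₃ z ^ p) := by
        refine lintegral_mono fun z => ?_
        refine (ENNReal.rpow_add_le_mul_rpow_add_rpow _ _ hp.le).trans ?_
        gcongr
        exact ENNReal.rpow_add_le_mul_rpow_add_rpow _ _ hp.le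
    _ = 2 ^ (p - 1) * (2 ^ (p - 1) * ((∫⁻ z, T₁ z ^ p) + ∫⁻ z, T₂ z ^ p) + ∫⁻ z, T₃ z ^ p) := by
        rw [lintegral_const_mul' _ _ (by simp [ENNReal.rpow_eq_top_iff]),
          lintegral_add_left (by fun_prop), lintegral_const_mul _ (by fun_prop),
          lintegral_add_left (by fun_prop)]
    _ ≤ 2 ^ (p - 1) * (2 ^ (p - 1) * (C₇ * C₁ * (‖η‖ₑ ^ p * J) + C₂ * C₇ * (‖η‖ₑ ^ p * J)) +
          C₄ * C₃ * D ^ p * (‖η‖ₑ ^ p * J)) := by gcongr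
    _ = _ := by ring

/-! ### Second differences of the kernel -/

/-- Since `2‖η‖ ≤ ‖a‖`, the points `a ± η` stay at distance at least `‖a‖ / 2` from zero. Each
difference factors into inverses, and each order of differencing gains `‖η‖ / ‖a‖`. -/
theorem norm_inv_second_difference_le {a η : ℂ} (ha : a ≠ 0) (h : 2 * ‖η‖ ≤ ‖a‖) :
    ‖(a - η)⁻¹‖ ≤ 2 / ‖a‖ ∧ ‖(a + η)⁻¹‖ ≤ 2 / ‖a‖ ∧
    ‖(a + η)⁻¹ - a⁻¹‖ ≤ 2 * ‖η‖ / ‖a‖ ^ 2 ∧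
    ‖(a - η)⁻¹ - (a + η)⁻¹‖ ≤ 8 * ‖η‖ / ‖a‖ ^ 2 ∧
    ‖(a - η)⁻¹ + (a + η)⁻¹ - 2 * a⁻¹‖ ≤ 8 * ‖η‖ ^ 2 / ‖a‖ ^ 3 := by
  have hA : 0 < ‖a‖ := norm_pos_iff.2 ha
  have hm : ‖a‖ / 2 ≤ ‖a - η‖ := by linarith [norm_sub_norm_le a η]
  have hp : ‖a‖ / 2 ≤ ‖a + η‖ := by linarith [norm_sub_le_norm_add a η]
  have hm0 : a - η ≠ 0 := norm_pos_iff.1 (by linarith)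
  have hp0 : a + η ≠ 0 := norm_pos_iff.1 (by linarith)
  have im : ‖(a - η)⁻¹‖ ≤ 2 / ‖a‖ := by
    rw [norm_inv, show 2 / ‖a‖ = (‖a‖ / 2)⁻¹ by field_simp]
    gcongr
  have ip : ‖(a + η)⁻¹‖ ≤ 2 / ‖a‖ := by
    rw [norm_inv, show 2 / ‖a‖ = (‖a‖ / 2)⁻¹ by field_simp]
    gcongr
  refine ⟨im, ip, ?_, ?_, ?_⟩
  · rw [show (a + η)⁻¹ - a⁻¹ = -η * a⁻¹ * (a + η)⁻¹ by field_simp; ring, norm_mul, norm_mul,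
      norm_neg, norm_inv]
    calc ‖η‖ * ‖a‖⁻¹ * ‖(a + η)⁻¹‖ ≤ ‖η‖ * ‖a‖⁻¹ * (2 / ‖a‖) := by gcongr
      _ = _ := by field_simp
  · rw [show (a - η)⁻¹ - (a + η)⁻¹ = 2 * η * (a - η)⁻¹ * (a + η)⁻¹ by field_simp; ring, norm_mul,
      norm_mul, norm_mul, Complex.norm_ofNat]
    calc 2 * ‖η‖ * ‖(a - η)⁻¹‖ * ‖(a + η)⁻¹‖ ≤ 2 * ‖η‖ * (2 / ‖a‖) * (2 / ‖a‖) := by gcongr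
      _ = _ := by field_simp; ring
  · rw [show (a - η)⁻¹ + (a + η)⁻¹ - 2 * a⁻¹ = 2 * η ^ 2 * a⁻¹ * (a - η)⁻¹ * (a + η)⁻¹ by
      field_simp; ring, norm_mul, norm_mul, norm_mul, norm_mul, Complex.norm_ofNat, norm_pow,
      norm_inv a]
    calc 2 * ‖η‖ ^ 2 * ‖a‖⁻¹ * ‖(a - η)⁻¹‖ * ‖(a + η)⁻¹‖
        ≤ 2 * ‖η‖ ^ 2 * ‖a‖⁻¹ * (2 / ‖a‖) * (2 / ‖a‖) := by gcongr
      _ = _ := by field_simp; ring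

/-- The second difference of a product of two Cauchy kernels away from both singularities. -/
theorem norm_second_difference_inv_mul_inv_le {a b η θ : ℂ} (ha : a ≠ 0) (hb : b ≠ 0)
    (hθ : ‖θ‖ = ‖η‖) (hηa : 2 * ‖η‖ ≤ ‖a‖) (hηb : 2 * ‖η‖ ≤ ‖b‖) :
    ‖2 * (a⁻¹ * b⁻¹) - (a - η)⁻¹ * (b + θ)⁻¹ - (a + η)⁻¹ * (b - θ)⁻¹‖ ≤
      30 * (‖η‖ ^ 2 / (‖η‖ ^ 2 + ‖a‖ ^ 2) * ‖a‖⁻¹ * ‖b‖⁻¹ +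
        ‖a‖⁻¹ * (‖η‖ ^ 2 / (‖η‖ ^ 2 + ‖b‖ ^ 2) * ‖b‖⁻¹)) := by
  obtain ⟨-, -, a₁, -, a₂⟩ := norm_inv_second_difference_le ha hηa
  obtain ⟨-, b₀, -, b₁, b₂⟩ := norm_inv_second_difference_le (η := θ) hb (by rwa [hθ])
  rw [hθ] at b₁ b₂
  have hA : 0 < ‖a‖ := norm_pos_iff.2 ha
  have hB : 0 < ‖b‖ := norm_pos_iff.2 hb
  set A := ‖a‖
  set B := ‖b‖
  set t := ‖η‖
  have ht : 0 ≤ t := norm_nonneg η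
  -- A discrete Leibniz rule: second differences of either factor, and a mixed product of first
  -- differences.
  have hid : 2 * (a⁻¹ * b⁻¹) - (a - η)⁻¹ * (b + θ)⁻¹ - (a + η)⁻¹ * (b - θ)⁻¹ =
      -(((a - η)⁻¹ + (a + η)⁻¹ - 2 * a⁻¹) * (b + θ)⁻¹ +
        ((a + η)⁻¹ - a⁻¹) * ((b - θ)⁻¹ - (b + θ)⁻¹) +
        a⁻¹ * ((b - θ)⁻¹ + (b + θ)⁻¹ - 2 * b⁻¹)) := by ring
  -- From `2t ≤ x`, `t² + x² ≤ (5/4) x²`.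
  have hfrac : ∀ x : ℝ, 0 < x → 2 * t ≤ x → t ^ 2 / x ^ 2 ≤ 5 / 4 * (t ^ 2 / (t ^ 2 + x ^ 2)) := by
    intro x hx hxt
    rw [← mul_div_assoc, div_le_div_iff₀ (by positivity) (by positivity)]
    nlinarith [mul_nonneg (sq_nonneg t) (sq_nonneg t), mul_le_mul hxt hxt (by positivity) hx.le,
      sq_nonneg t]
  -- The mixed term is absorbed by the two others through `2 A⁻¹ B⁻¹ ≤ A⁻² + B⁻²`.
  have hamgm : t ^ 2 / (A ^ 2 * B ^ 2) ≤
      1 / 2 * (t ^ 2 / A ^ 2 * A⁻¹ * B⁻¹ + A⁻¹ * (t ^ 2 / B ^ 2 * B⁻¹)) := by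
    have h1 : 1 / 2 * (t ^ 2 / A ^ 2 * A⁻¹ * B⁻¹ + A⁻¹ * (t ^ 2 / B ^ 2 * B⁻¹)) -
        t ^ 2 / (A ^ 2 * B ^ 2) = 1 / 2 * t ^ 2 * A⁻¹ * B⁻¹ * (A⁻¹ - B⁻¹) ^ 2 := by
      field_simp; ring
    have : 0 ≤ 1 / 2 * t ^ 2 * A⁻¹ * B⁻¹ * (A⁻¹ - B⁻¹) ^ 2 := by positivity
    linarith
  rw [hid, norm_neg]
  have s₁ : ‖((a - η)⁻¹ + (a + η)⁻¹ - 2 * a⁻¹) * (b + θ)⁻¹‖ ≤ 8 * t ^ 2 / A ^ 3 * (2 / B) := by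
    rw [norm_mul]; gcongr
  have s₂ : ‖((a + η)⁻¹ - a⁻¹) * ((b - θ)⁻¹ - (b + θ)⁻¹)‖ ≤ 2 * t / A ^ 2 * (8 * t / B ^ 2) := by
    rw [norm_mul]; gcongr
  have s₃ : ‖a⁻¹ * ((b - θ)⁻¹ + (b + θ)⁻¹ - 2 * b⁻¹)‖ ≤ A⁻¹ * (8 * t ^ 2 / B ^ 3) := by
    rw [norm_mul, norm_inv]; gcongr
  have r₁ : 8 * t ^ 2 / A ^ 3 * (2 / B) = 16 * (t ^ 2 / A ^ 2 * A⁻¹ * B⁻¹) := by field_simp; ring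
  have r₂ : 2 * t / A ^ 2 * (8 * t / B ^ 2) = 16 * (t ^ 2 / (A ^ 2 * B ^ 2)) := by
    field_simp; ring
  have r₃ : A⁻¹ * (8 * t ^ 2 / B ^ 3) = 8 * (A⁻¹ * (t ^ 2 / B ^ 2 * B⁻¹)) := by field_simp
  have q₁ : t ^ 2 / A ^ 2 * A⁻¹ * B⁻¹ ≤ 5 / 4 * (t ^ 2 / (t ^ 2 + A ^ 2) * A⁻¹ * B⁻¹) := by
    calc _ ≤ 5 / 4 * (t ^ 2 / (t ^ 2 + A ^ 2)) * A⁻¹ * B⁻¹ := by gcongr; exact hfrac A hA hηa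
      _ = _ := by ring
  have q₂ : A⁻¹ * (t ^ 2 / B ^ 2 * B⁻¹) ≤ 5 / 4 * (A⁻¹ * (t ^ 2 / (t ^ 2 + B ^ 2) * B⁻¹)) := by
    calc _ ≤ A⁻¹ * (5 / 4 * (t ^ 2 / (t ^ 2 + B ^ 2)) * B⁻¹) := by gcongr; exact hfrac B hB hηb
      _ = _ := by ring
  -- The terms sum to `24` and `16` times the left sides of `q₁` and `q₂`; the factor `5/4` gives
  -- `30` and `20`, and positivity raises `20` to `30`.
  have q₃ : 0 ≤ A⁻¹ * (t ^ 2 / (t ^ 2 + B ^ 2) * B⁻¹) := by positivity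
  refine (norm_add₃_le).trans ?_
  linarith

/-- The kernel of the composition of the two Cauchy transforms through the domain `Ω`. -/
noncomputable def pairKernel (Ω : Set ℂ) (z w : ℂ) : ℂ → ℂ :=
  Ω.indicator fun v => (z - v)⁻¹ * (conj (v - w))⁻¹

/-- The positive majorant of the second difference of `pairKernel`. -/
noncomputable def pairMajorant (Ω : Set ℂ) (η z w : ℂ) : ℂ → ENNReal := fun v =>
  Ω.indicator (fun v => bumpKernel ‖η‖ (z - v) * ‖v - w‖ₑ⁻¹ +
    ‖z - v‖ₑ⁻¹ * bumpKernel ‖η‖ (v - w)) v +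
  (boundaryStrip Ω η).indicator (fun v => ‖z - v‖ₑ⁻¹ * ‖v - w‖ₑ⁻¹) v

theorem enorm_inv_le (x : ℂ) : ‖x⁻¹‖ₑ ≤ ‖x‖ₑ⁻¹ := by
  rcases eq_or_ne x 0 with rfl | h
  · simp
  · rw [enorm_inv h]

theorem enorm_conj (x : ℂ) : ‖conj x‖ₑ = ‖x‖ₑ := by
  rw [← ofReal_norm, ← ofReal_norm, Complex.norm_conj]

theorem enorm_pairKernel_le {Ω : Set ℂ} {z w v : ℂ} :
    ‖pairKernel Ω z w v‖ₑ ≤ ‖z - v‖ₑ⁻¹ * ‖v - w‖ₑ⁻¹ := by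
  by_cases hv : v ∈ Ω
  · rw [pairKernel, Set.indicator_of_mem hv, enorm_mul]
    gcongr
    · exact enorm_inv_le _
    · exact (enorm_inv_le _).trans_eq (by rw [enorm_conj])
  · rw [pairKernel, Set.indicator_of_notMem hv]; simp

/-- Within `3τ` the cutoff factor is at least `1 / (1 + 3²)`, whence the `10`. -/
theorem inv_enorm_le_bumpKernel {τ : ℝ} {x : ℂ} (hτ : 0 < τ) (h : ‖x‖ ≤ 3 * τ) :
    ‖x‖ₑ⁻¹ ≤ 10 * bumpKernel τ x := by
  rw [bumpKernel, ← mul_assoc]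
  refine le_mul_of_one_le_left' ?_
  rw [show (10 : ENNReal) = ENNReal.ofReal 10 by simp, ← ENNReal.ofReal_mul (by norm_num),
    ← ENNReal.ofReal_one]
  refine ENNReal.ofReal_le_ofReal ?_
  rw [← mul_div_assoc, one_le_div (by positivity)]
  nlinarith [norm_nonneg x]

theorem enorm_pairKernel_le_of_mem_boundaryStrip {Ω : Set ℂ} {η z w v : ℂ}
    (h : v ∈ Ω → v ∈ boundaryStrip Ω η) :
    ‖pairKernel Ω z w v‖ₑ ≤ pairMajorant Ω η z w v := by
  by_cases hv : v ∈ Ω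
  · refine enorm_pairKernel_le.trans ?_
    rw [pairMajorant, Set.indicator_of_mem (h hv)]
    exact le_add_self
  · rw [pairKernel, Set.indicator_of_notMem hv]; simp

theorem enorm_pairKernel_le_of_near {Ω : Set ℂ} {η z w v : ℂ} (hη : η ≠ 0) (hv : v ∈ Ω)
    (h : ‖z - v‖ ≤ 3 * ‖η‖ ∨ ‖v - w‖ ≤ 3 * ‖η‖) :
    ‖pairKernel Ω z w v‖ₑ ≤ 10 * pairMajorant Ω η z w v := by
  have hτ : 0 < ‖η‖ := norm_pos_iff.2 hη
  refine enorm_pairKernel_le.trans ?_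
  rw [pairMajorant, Set.indicator_of_mem hv]
  rcases h with h | h
  · calc ‖z - v‖ₑ⁻¹ * ‖v - w‖ₑ⁻¹ ≤ 10 * bumpKernel ‖η‖ (z - v) * ‖v - w‖ₑ⁻¹ := by
          gcongr; exact inv_enorm_le_bumpKernel hτ h
      _ ≤ _ := by
          rw [mul_assoc]; gcongr; rw [add_assoc]; exact le_self_add
  · calc ‖z - v‖ₑ⁻¹ * ‖v - w‖ₑ⁻¹ ≤ ‖z - v‖ₑ⁻¹ * (10 * bumpKernel ‖η‖ (v - w)) := by
          gcongr; exact inv_enorm_le_bumpKernel hτ h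
      _ ≤ _ := by
          rw [mul_left_comm]; gcongr; exact le_add_right le_add_self

/-- By convexity a point that leaves `Ω` after one step cannot be back in it after two. A strip
defined by translations by `±2η` thus also catches exits under `±η`. -/
theorem add_two_mul_notMem {Ω : Set ℂ} (hc : Convex ℝ Ω) {v η : ℂ} (hv : v ∈ Ω)
    (h : v + η ∉ Ω) : v + 2 * η ∉ Ω := by
  intro h2
  refine h ?_
  have := hc.midpoint_mem hv h2
  rwa [midpoint_eq_smul_add, show (⅟2 : ℝ) • (v + (v + 2 * η)) = v + η by
    rw [invOf_eq_inv, Complex.real_smul]; push_cast; ring] at this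

theorem mem_boundaryStrip_of_add {Ω : Set ℂ} (hc : Convex ℝ Ω) {v η : ℂ} (hv : v ∈ Ω)
    (h : v + η ∉ Ω ∨ v - η ∉ Ω ∨ v + 2 * η ∉ Ω ∨ v - 2 * η ∉ Ω) : v ∈ boundaryStrip Ω η := by
  rcases h with h | h | h | h
  · exact .inl ⟨hv, add_two_mul_notMem hc hv h⟩
  · refine .inr ⟨hv, ?_⟩
    rw [sub_eq_add_neg] at h
    simpa using add_two_mul_notMem hc hv h
  · exact .inl ⟨hv, h⟩
  · exact .inr ⟨hv, by rwa [← sub_eq_add_neg]⟩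

/-- Cancellation is used only when the three points lie in `Ω` and `v` is at distance at least
`2‖η‖` from `z` and `w`. Near a singularity, or when a point is outside `Ω`, each of the three
values is bounded separately. -/
theorem enorm_second_difference_pairKernel_le {Ω : Set ℂ} (hc : Convex ℝ Ω) {η : ℂ} (hη : η ≠ 0)
    (z w v : ℂ) :
    ‖2 * pairKernel Ω z w v - pairKernel Ω z w (v + η) - pairKernel Ω z w (v - η)‖ₑ ≤
      30 * (pairMajorant Ω η z w v + pairMajorant Ω η z w (v + η) +
        pairMajorant Ω η z w (v - η)) := by
  have hτ : 0 < ‖η‖ := norm_pos_iff.2 hη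
  have htri : ∀ x y t : ℂ, ‖2 * x - y - t‖ₑ ≤ 2 * ‖x‖ₑ + ‖y‖ₑ + ‖t‖ₑ := by
    intro x y t
    refine enorm_sub_le.trans ?_
    gcongr
    refine enorm_sub_le.trans ?_
    gcongr
    rw [two_mul, two_mul]
    exact enorm_add_le _ _
  have hcollect : ∀ a b c : ENNReal, 2 * (10 * a) + 10 * b + 10 * c ≤ 30 * (a + b + c) := by
    intro a b c
    calc 2 * (10 * a) + 10 * b + 10 * c = (2 * 10) * a + 10 * b + 10 * c := by ring
      _ ≤ 30 * a + 30 * b + 30 * c := by gcongr <;> norm_num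
      _ = _ := by ring
  have hbound : ‖pairKernel Ω z w v‖ₑ ≤ 10 * pairMajorant Ω η z w v →
      ‖pairKernel Ω z w (v + η)‖ₑ ≤ 10 * pairMajorant Ω η z w (v + η) →
      ‖pairKernel Ω z w (v - η)‖ₑ ≤ 10 * pairMajorant Ω η z w (v - η) →
      ‖2 * pairKernel Ω z w v - pairKernel Ω z w (v + η) - pairKernel Ω z w (v - η)‖ₑ ≤
      30 * (pairMajorant Ω η z w v + pairMajorant Ω η z w (v + η) +
        pairMajorant Ω η z w (v - η)) := fun h0 h1 h2 =>
    (htri _ _ _).trans ((by gcongr : _ ≤ _).trans (hcollect _ _ _))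
  by_cases hall : v ∈ Ω ∧ v + η ∈ Ω ∧ v - η ∈ Ω
  · obtain ⟨h0, h1, h2⟩ := hall
    -- Closeness `2‖η‖` at `v` becomes at most `3‖η‖` at `v ± η`, the range of
    -- `enorm_pairKernel_le_of_near`.
    by_cases hnear : ‖z - v‖ < 2 * ‖η‖ ∨ ‖v - w‖ < 2 * ‖η‖
    · refine hbound (enorm_pairKernel_le_of_near hη h0 ?_)
        (enorm_pairKernel_le_of_near hη h1 ?_) (enorm_pairKernel_le_of_near hη h2 ?_)
      · exact hnear.imp (fun h => by linarith) fun h => by linarith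
      · refine hnear.imp (fun h => ?_) fun h => ?_
        · rw [show z - (v + η) = (z - v) - η by ring]; linarith [norm_sub_le (z - v) η]
        · rw [show v + η - w = (v - w) + η by ring]; linarith [norm_add_le (v - w) η]
      · refine hnear.imp (fun h => ?_) fun h => ?_
        · rw [show z - (v - η) = (z - v) + η by ring]; linarith [norm_add_le (z - v) η]
        · rw [show v - η - w = (v - w) - η by ring]; linarith [norm_sub_le (v - w) η]
    · push Not at hnear
      obtain ⟨hza, hwb⟩ := hnear
      have hz0 : 0 < ‖z - v‖ := by linarith
      have hw0 : 0 < ‖v - w‖ := by linarith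
      have hreal := norm_second_difference_inv_mul_inv_le (a := z - v) (b := conj (v - w))
        (η := η) (θ := conj η) (norm_pos_iff.1 hz0)
        (norm_pos_iff.1 (by rwa [Complex.norm_conj])) (Complex.norm_conj η) hza
        (by rwa [Complex.norm_conj])
      rw [Complex.norm_conj] at hreal
      refine le_trans ?_ (mul_le_mul_right (le_add_right le_self_add) 30)
      rw [pairMajorant, Set.indicator_of_mem h0]
      refine le_trans ?_ (mul_le_mul_right le_self_add 30)
      rw [pairKernel, Set.indicator_of_mem h0, Set.indicator_of_mem h1, Set.indicator_of_mem h2,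
        show z - (v + η) = z - v - η by ring, show z - (v - η) = z - v + η by ring,
        show conj (v + η - w) = conj (v - w) + conj η by rw [← map_add]; congr 1; ring,
        show conj (v - η - w) = conj (v - w) - conj η by rw [← map_sub]; congr 1; ring,
        ← ofReal_norm]
      refine (ENNReal.ofReal_le_ofReal hreal).trans_eq ?_
      rw [ENNReal.ofReal_mul (by norm_num), ENNReal.ofReal_add (by positivity) (by positivity),
        ENNReal.ofReal_mul (by positivity), ENNReal.ofReal_mul (by positivity),
        ENNReal.ofReal_mul (by positivity), ENNReal.ofReal_mul (by positivity),
        ENNReal.ofReal_inv_of_pos hz0, ENNReal.ofReal_inv_of_pos hw0, ofReal_norm, ofReal_norm,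
        bumpKernel, bumpKernel]
      simp
  -- The three points differ pairwise by `±η` or `±2η`, so once one of them is outside `Ω`, each one
  -- inside is in the strip.
  · have hS : ∀ x, x = v ∨ x = v + η ∨ x = v - η → x ∈ Ω → x ∈ boundaryStrip Ω η := by
      intro x hx hxΩ
      refine mem_boundaryStrip_of_add hc hxΩ ?_
      by_contra hcon
      push Not at hcon
      obtain ⟨c1, c2, c3, c4⟩ := hcon
      refine hall ?_
      rcases hx with rfl | rfl | rfl
      · exact ⟨hxΩ, c1, c2⟩
      · refine ⟨by simpa using c2, hxΩ, ?_⟩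
        rwa [show v + η - 2 * η = v - η by ring] at c4
      · refine ⟨by simpa using c1, ?_, hxΩ⟩
        rwa [show v - η + 2 * η = v + η by ring] at c3
    have hle : ∀ a : ENNReal, a ≤ 10 * a := fun a => le_mul_of_one_le_left' (by norm_num)
    exact hbound ((enorm_pairKernel_le_of_mem_boundaryStrip (hS _ (.inl rfl))).trans (hle _))
      ((enorm_pairKernel_le_of_mem_boundaryStrip (hS _ (.inr (.inl rfl)))).trans (hle _))
      ((enorm_pairKernel_le_of_mem_boundaryStrip (hS _ (.inr (.inr rfl)))).trans (hle _))

/-! ### Oscillatory integrals -/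

theorem integral_second_difference {f g h : ℂ → ℂ} (hf : Integrable f) (hg : Integrable g)
    (hh : Integrable h) :
    ∫ v, (2 * f v - g v - h v) = 2 * (∫ v, f v) - (∫ v, g v) - ∫ v, h v := by
  have h1 : Integrable fun v => 2 * f v - g v := (hf.const_mul 2).sub hg
  rw [integral_sub h1 hh, integral_sub (hf.const_mul 2) hg, integral_const_mul]

/-- Integrals against an oscillating factor are controlled by second differences over half a
period. -/
theorem enorm_integral_mul_le_second_difference {e Q : ℂ → ℂ} {η : ℂ} (he : ∀ v, ‖e v‖ = 1)
    (heη : ∀ v, e (v + η) = -e v) :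
    ‖∫ v, e v * Q v‖ₑ ≤ ∫⁻ v, ‖2 * Q v - Q (v + η) - Q (v - η)‖ₑ := by
  by_cases hint : Integrable fun v => e v * Q v
  swap
  -- The Bochner integral of a non-integrable function is `0` by convention.
  · rw [integral_undef hint]; simp
  have heη' : ∀ v, e (v - η) = -e v := fun v => by
    have := heη (v - η)
    rw [sub_add_cancel] at this
    rw [this, neg_neg]
  have e1 : ∀ v, e v * Q (v + η) = -(e (v + η) * Q (v + η)) := fun v => by rw [heη]; ring
  have e2 : ∀ v, e v * Q (v - η) = -(e (v - η) * Q (v - η)) := fun v => by rw [heη']; ring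
  have i1 : Integrable fun v => e v * Q (v + η) := by
    simp_rw [e1]; exact (hint.comp_add_right η).neg
  have i2 : Integrable fun v => e v * Q (v - η) := by
    simp_rw [e2]; exact (hint.comp_sub_right η).neg
  have v1 : ∫ v, e v * Q (v + η) = -∫ v, e v * Q v := by
    simp_rw [e1]
    rw [integral_neg, integral_add_right_eq_self (fun v => e v * Q v)]
  have v2 : ∫ v, e v * Q (v - η) = -∫ v, e v * Q v := by
    simp_rw [e2]
    rw [integral_neg, integral_sub_right_eq_self (fun v => e v * Q v)]
  -- Each translated integral is minus the original one, so the coefficients add up to `2 + 1 + 1`.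
  have h4 : ∫ v, e v * (2 * Q v - Q (v + η) - Q (v - η)) = 4 * ∫ v, e v * Q v := by
    have : ∀ v, e v * (2 * Q v - Q (v + η) - Q (v - η)) =
        2 * (e v * Q v) - e v * Q (v + η) - e v * Q (v - η) := fun v => by ring
    simp_rw [this]
    rw [integral_second_difference hint i1 i2, v1, v2]
    ring
  calc ‖∫ v, e v * Q v‖ₑ ≤ ‖(4 : ℂ) * ∫ v, e v * Q v‖ₑ := by
        rw [enorm_mul]
        refine le_mul_of_one_le_left' ?_
        rw [← ofReal_norm]; simp
    _ ≤ ∫⁻ v, ‖e v * (2 * Q v - Q (v + η) - Q (v - η))‖ₑ := by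
        rw [← h4]; exact enorm_integral_le_lintegral_enorm _
    _ = _ := by
        refine lintegral_congr fun v => ?_
        rw [enorm_mul, ← ofReal_norm (e v), he, ENNReal.ofReal_one, one_mul]

theorem lintegral_pairMajorant {Ω : Set ℂ} (hΩ : IsOpen Ω) (η z : ℂ) {U : ℂ → ENNReal}
    (hU : Measurable U) :
    ∫⁻ v, ∫⁻ w in Ω, pairMajorant Ω η z w v * U w = majorant Ω η U z := by
  have hS := measurableSet_boundaryStrip hΩ η
  have hNm : Measurable fun v : ℂ => ∫⁻ w in Ω, ‖v - w‖ₑ⁻¹ * U w :=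
    Measurable.lintegral_prod_right' (f := fun q : ℂ × ℂ => ‖q.1 - q.2‖ₑ⁻¹ * U q.2) (by fun_prop)
  have hQm : Measurable fun v : ℂ => ∫⁻ w in Ω, bumpKernel ‖η‖ (v - w) * U w :=
    Measurable.lintegral_prod_right' (f := fun q : ℂ × ℂ => bumpKernel ‖η‖ (q.1 - q.2) * U q.2)
      (by fun_prop)
  have hinner : ∀ v, ∫⁻ w in Ω, pairMajorant Ω η z w v * U w =
      Ω.indicator (fun v => bumpKernel ‖η‖ (z - v) * ∫⁻ w in Ω, ‖v - w‖ₑ⁻¹ * U w) v +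
      Ω.indicator (fun v => ‖z - v‖ₑ⁻¹ * ∫⁻ w in Ω, bumpKernel ‖η‖ (v - w) * U w) v +
      (boundaryStrip Ω η).indicator
        (fun v => ‖z - v‖ₑ⁻¹ * ∫⁻ w in Ω, ‖v - w‖ₑ⁻¹ * U w) v := by
    intro v
    have h1 : ∫⁻ w in Ω, (bumpKernel ‖η‖ (z - v) * ‖v - w‖ₑ⁻¹ +
        ‖z - v‖ₑ⁻¹ * bumpKernel ‖η‖ (v - w)) * U w =
        bumpKernel ‖η‖ (z - v) * (∫⁻ w in Ω, ‖v - w‖ₑ⁻¹ * U w) +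
        ‖z - v‖ₑ⁻¹ * ∫⁻ w in Ω, bumpKernel ‖η‖ (v - w) * U w := by
      simp_rw [add_mul, mul_assoc]
      rw [lintegral_add_left (by fun_prop), lintegral_const_mul _ (by fun_prop),
        lintegral_const_mul _ (by fun_prop)]
    have h2 : ∫⁻ w in Ω, ‖z - v‖ₑ⁻¹ * ‖v - w‖ₑ⁻¹ * U w =
        ‖z - v‖ₑ⁻¹ * ∫⁻ w in Ω, ‖v - w‖ₑ⁻¹ * U w := by
      simp_rw [mul_assoc]
      rw [lintegral_const_mul _ (by fun_prop)]
    by_cases hv : v ∈ Ω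
    · by_cases hvS : v ∈ boundaryStrip Ω η
      · simp only [pairMajorant, Set.indicator_of_mem hv, Set.indicator_of_mem hvS]
        rw [← h2, ← h1, ← lintegral_add_left (by fun_prop)]
        simp_rw [← add_mul]
      · simp only [pairMajorant, Set.indicator_of_mem hv, Set.indicator_of_notMem hvS, add_zero]
        exact h1
    · have hvS : v ∉ boundaryStrip Ω η := fun h => hv (boundaryStrip_subset Ω η h)
      simp [pairMajorant, Set.indicator_of_notMem hv, Set.indicator_of_notMem hvS]
  simp_rw [hinner]
  rw [lintegral_add_right _ (Measurable.indicator (by fun_prop) hS),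
    lintegral_add_right _ (Measurable.indicator (by fun_prop) hΩ.measurableSet),
    lintegral_indicator hΩ.measurableSet, lintegral_indicator hΩ.measurableSet,
    lintegral_indicator hS, majorant]

theorem measurable_lintegral_pairMajorant {Ω : Set ℂ} (hΩ : IsOpen Ω) (η z : ℂ) {U : ℂ → ENNReal}
    (hU : Measurable U) : Measurable fun v => ∫⁻ w in Ω, pairMajorant Ω η z w v * U w := by
  refine Measurable.lintegral_prod_right' (f := fun q : ℂ × ℂ => pairMajorant Ω η z q.2 q.1 * U q.2)
    (Measurable.mul ?_ (by fun_prop))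
  refine Measurable.add ?_ ?_
  · exact Measurable.indicator (f := fun q : ℂ × ℂ => bumpKernel ‖η‖ (z - q.1) * ‖q.1 - q.2‖ₑ⁻¹ +
      ‖z - q.1‖ₑ⁻¹ * bumpKernel ‖η‖ (q.1 - q.2)) (by fun_prop)
      (measurable_fst hΩ.measurableSet)
  · exact Measurable.indicator (f := fun q : ℂ × ℂ => ‖z - q.1‖ₑ⁻¹ * ‖q.1 - q.2‖ₑ⁻¹) (by fun_prop)
      (measurable_fst (measurableSet_boundaryStrip hΩ η))

/-- An oscillatory integral of a Cauchy transform is dominated by `majorant`. -/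
theorem enorm_integral_osc_cauchy_le {Ω : Set ℂ} (hΩ : IsOpen Ω) (hc : Convex ℝ Ω) {e f : ℂ → ℂ}
    {η : ℂ} (hη : η ≠ 0) (he : ∀ v, ‖e v‖ = 1) (heη : ∀ v, e (v + η) = -e v) (hf : Measurable f)
    (hfΩ : ∀ w, w ∉ Ω → f w = 0)
    (hfin : ∀ᵐ v : ℂ, ∫⁻ w in Ω, ‖v - w‖ₑ⁻¹ * ‖f w‖ₑ < ⊤) (z : ℂ) :
    ‖∫ v, e v * Ω.indicator (fun v => (z - v)⁻¹ * ∫ w, f w / conj (v - w)) v‖ₑ ≤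
      90 * majorant Ω η (fun w => ‖f w‖ₑ) z := by
  have hU : Measurable fun w => ‖f w‖ₑ := hf.enorm
  refine (enorm_integral_mul_le_second_difference he heη).trans ?_
  -- With the `w`-integral outside, the second difference in `v` falls on `pairKernel` alone, at
  -- fixed `w`.
  have hQ : ∀ v, Ω.indicator (fun v => (z - v)⁻¹ * ∫ w, f w / conj (v - w)) v =
      ∫ w, f w * pairKernel Ω z w v := by
    intro v
    by_cases hv : v ∈ Ω
    · rw [Set.indicator_of_mem hv, ← integral_const_mul]
      congr 1 with w
      rw [pairKernel, Set.indicator_of_mem hv]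
      ring
    · rw [Set.indicator_of_notMem hv]
      simp [pairKernel, Set.indicator_of_notMem hv]
  have hfm : ∀ v, Measurable fun w => f w / conj (v - w) := fun v =>
    hf.div (Complex.continuous_conj.measurable.comp (by fun_prop))
  have hI : ∀ v, ∫⁻ w in Ω, ‖v - w‖ₑ⁻¹ * ‖f w‖ₑ < ⊤ →
      Integrable fun w => f w * pairKernel Ω z w v := by
    intro v hv
    have h1 : Integrable fun w => f w / conj (v - w) := by
      refine ⟨(hfm v).aestronglyMeasurable, lt_of_le_of_lt ?_ hv⟩
      rw [← lintegral_indicator hΩ.measurableSet]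
      refine lintegral_mono fun w => ?_
      beta_reduce
      by_cases hw : w ∈ Ω
      · rw [Set.indicator_of_mem hw, div_eq_mul_inv, enorm_mul, mul_comm]
        gcongr
        exact (enorm_inv_le _).trans_eq (by rw [enorm_conj])
      · rw [hfΩ w hw]; simp
    by_cases hvΩ : v ∈ Ω
    · refine (h1.const_mul (z - v)⁻¹).congr (.of_forall fun w => ?_)
      simp only [pairKernel, Set.indicator_of_mem hvΩ]
      ring
    · simp [pairKernel, Set.indicator_of_notMem hvΩ]
  have hfin1 : ∀ᵐ v : ℂ, ∫⁻ w in Ω, ‖v + η - w‖ₑ⁻¹ * ‖f w‖ₑ < ⊤ :=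
    (measurePreserving_add_right volume η).quasiMeasurePreserving.ae hfin
  have hfin2 : ∀ᵐ v : ℂ, ∫⁻ w in Ω, ‖v - η - w‖ₑ⁻¹ * ‖f w‖ₑ < ⊤ :=
    (measurePreserving_sub_right volume η).quasiMeasurePreserving.ae hfin
  set P : ℂ → ENNReal := fun v => ∫⁻ w in Ω, pairMajorant Ω η z w v * ‖f w‖ₑ with hP
  have hPm : Measurable P := measurable_lintegral_pairMajorant hΩ η z hU
  have hPk : ∀ v, Measurable fun w => pairMajorant Ω η z w v * ‖f w‖ₑ := by
    intro v
    refine Measurable.mul (Measurable.add ?_ ?_) hU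
    · by_cases hv : v ∈ Ω
      · simp only [Set.indicator_of_mem hv]; fun_prop
      · simp only [Set.indicator_of_notMem hv]; fun_prop
    · by_cases hv : v ∈ boundaryStrip Ω η
      · simp only [Set.indicator_of_mem hv]; fun_prop
      · simp only [Set.indicator_of_notMem hv]; fun_prop
  calc _ ≤ ∫⁻ v, 30 * (P v + P (v + η) + P (v - η)) := by
        refine lintegral_mono_ae ?_
        filter_upwards [hfin, hfin1, hfin2] with v h0 h1 h2
        rw [hQ, hQ, hQ, ← integral_second_difference (hI v h0) (hI _ h1) (hI _ h2)]
        refine (enorm_integral_le_lintegral_enorm _).trans ?_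
        calc _ ≤ ∫⁻ w, Ω.indicator (fun w => 30 * (pairMajorant Ω η z w v * ‖f w‖ₑ +
              pairMajorant Ω η z w (v + η) * ‖f w‖ₑ +
              pairMajorant Ω η z w (v - η) * ‖f w‖ₑ)) w := by
              refine lintegral_mono fun w => ?_
              by_cases hw : w ∈ Ω
              · rw [Set.indicator_of_mem hw, show 2 * (f w * pairKernel Ω z w v) -
                  f w * pairKernel Ω z w (v + η) - f w * pairKernel Ω z w (v - η) =
                  (2 * pairKernel Ω z w v - pairKernel Ω z w (v + η) -
                    pairKernel Ω z w (v - η)) * f w by ring, enorm_mul, ← add_mul, ← add_mul,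
                  ← mul_assoc]
                gcongr
                exact enorm_second_difference_pairKernel_le hc hη z w v
              · simp [hfΩ w hw]
          _ = _ := by
              rw [lintegral_indicator hΩ.measurableSet,
                lintegral_const_mul' _ _ (by simp), lintegral_add_right _ (hPk _),
                lintegral_add_left (hPk v)]
    -- Translation invariance makes the three integrals equal, whence `3 * 30 = 90`.
    _ = 30 * ((∫⁻ v, P v) + (∫⁻ v, P v) + ∫⁻ v, P v) := by
        rw [lintegral_const_mul _ (by fun_prop), lintegral_add_left (by fun_prop),
          lintegral_add_left hPm, lintegral_add_right_eq_self P, lintegral_sub_right_eq_self P]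
    _ = 90 * majorant Ω η (fun w => ‖f w‖ₑ) z := by
        rw [hP, lintegral_pairMajorant hΩ η z hU]
        ring

/-! ### Change of representative and measurability -/

theorem norm_exp_sub_conj (x : ℂ) : ‖Complex.exp (x - conj x)‖ = 1 := by
  rw [Complex.norm_exp]; simp

theorem oscMul_congr_ae {k : ℂ} {u v : ℂ → ℂ} (h : u =ᵐ[volume] v) :
    oscMul k u =ᵐ[volume] oscMul k v := by
  filter_upwards [h] with z hz
  rw [oscMul, oscMul, hz]

theorem sourceB_congr_ae {q : ℂ → ℂ} {k : ℂ} {u v : ℂ → ℂ} (h : u =ᵐ[volume] v) :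
    sourceB q k u =ᵐ[volume] sourceB q k v :=
  oscMul_congr_ae (h.mono fun w hw => by simp only [hw])

/-- The function `u` enters only under an integral, so the equality holds at every point. This
allows `u` to be replaced by a measurable representative. -/
theorem opB_congr_ae {q : ℂ → ℂ} {σ : ℝ} {k : ℂ} {u v : ℂ → ℂ} (h : u =ᵐ[volume] v) :
    opB q σ k u = opB q σ k v := by
  funext z
  rw [opB, opB, dInv, dInv]
  congr 2
  refine integral_congr_ae ?_
  filter_upwards [sourceB_congr_ae h] with w hw
  rw [hw]

theorem opAB_congr_ae {q : ℂ → ℂ} {σ : ℝ} {k : ℂ} {u v : ℂ → ℂ} (h : u =ᵐ[volume] v) :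
    opAB q σ k u = opAB q σ k v := by
  rw [opAB, opAB, opB_congr_ae h]

theorem opABConverges_congr_ae {q : ℂ → ℂ} {σ : ℝ} {k : ℂ} {u v : ℂ → ℂ} (h : u =ᵐ[volume] v) :
    OpABConverges q σ k u ↔ OpABConverges q σ k v := by
  rw [OpABConverges, OpABConverges, opB_congr_ae h]
  refine and_congr_left' ?_
  have : ∀ z, Integrable (fun w => sourceB q k u w / conj (z - w)) ↔
      Integrable (fun w => sourceB q k v w / conj (z - w)) := fun z =>
    integrable_congr ((sourceB_congr_ae (q := q) (k := k) h).mono fun w hw => by simp only [hw])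
  simp_rw [this]

theorem measurable_oscMul {k : ℂ} {u : ℂ → ℂ} (hu : Measurable u) : Measurable (oscMul k u) := by
  refine Measurable.mul (Continuous.measurable ?_) hu
  have := Complex.continuous_conj
  fun_prop

theorem measurable_sourceA {q : ℂ → ℂ} {k : ℂ} {u : ℂ → ℂ} (hq : Measurable q)
    (hu : Measurable u) : Measurable (sourceA q k u) :=
  measurable_oscMul (by fun_prop)

theorem measurable_sourceB {q : ℂ → ℂ} {k : ℂ} {u : ℂ → ℂ} (hq : Measurable q)
    (hu : Measurable u) : Measurable (sourceB q k u) := by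
  have := Complex.continuous_conj.measurable.comp hq
  exact measurable_oscMul (((this.const_mul _).div_const _).mul hu)

theorem measurable_opA {q : ℂ → ℂ} {k : ℂ} {u : ℂ → ℂ} (hq : Measurable q) (hu : Measurable u) :
    Measurable (opA q k u) := by
  have hs := measurable_sourceA (k := k) hq hu
  refine Measurable.const_mul (StronglyMeasurable.measurable ?_) _
  refine StronglyMeasurable.integral_prod_right (f := fun z w => sourceA q k u w / (z - w)) ?_
  exact Measurable.stronglyMeasurable ((hs.comp measurable_snd).div (by fun_prop))

theorem measurable_opB {q : ℂ → ℂ} {σ : ℝ} {k : ℂ} {u : ℂ → ℂ} (hq : Measurable q)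
    (hu : Measurable u) : Measurable (opB q σ k u) := by
  have hs := measurable_sourceB (k := k) hq hu
  refine Measurable.const_mul (Measurable.const_mul (StronglyMeasurable.measurable ?_) _) _
  refine StronglyMeasurable.integral_prod_right
    (f := fun z w => sourceB q k u w / conj (z - w)) ?_
  exact Measurable.stronglyMeasurable ((hs.comp measurable_snd).div
    (Complex.continuous_conj.measurable.comp (by fun_prop)))

/-! ### The operators as oscillatory integrals -/

/-- The oscillating density whose Cauchy transform is `opB`. -/
noncomputable def oscDensity (Ω : Set ℂ) (k : ℂ) (u : ℂ → ℂ) : ℂ → ℂ := oscMul k (Ω.indicator u)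

theorem enorm_oscDensity (Ω : Set ℂ) (k : ℂ) (u : ℂ → ℂ) (w : ℂ) :
    ‖oscDensity Ω k u w‖ₑ = Ω.indicator (fun w => ‖u w‖ₑ) w := by
  rw [oscDensity, oscMul, enorm_mul, ← ofReal_norm (Complex.exp _), norm_exp_sub_conj,
    ENNReal.ofReal_one, one_mul, enorm_indicator_eq_indicator_enorm]

theorem sourceB_indicator (Ω : Set ℂ) (k : ℂ) (u : ℂ → ℂ) (w : ℂ) :
    sourceB (Ω.indicator 1) k u w = ((1 / ‖k‖ : ℝ) : ℂ) / 2 * oscDensity Ω k u w := by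
  by_cases hw : w ∈ Ω
  · simp [sourceB, oscDensity, oscMul, hw]; ring
  · simp [sourceB, oscDensity, oscMul, hw]

/-- The factor `h / 2` of the source cancels against `1 / (π h)`, leaving no explicit power of
`|k|`. -/
theorem opB_indicator (Ω : Set ℂ) (σ : ℝ) {k : ℂ} (hk : k ≠ 0) (u : ℂ → ℂ) (v : ℂ) :
    opB (Ω.indicator 1) σ k u v =
      (σ : ℂ) / (2 * Real.pi) * ∫ w, oscDensity Ω k u w / conj (v - w) := by
  have hk' : (‖k‖ : ℂ) ≠ 0 := by exact_mod_cast norm_ne_zero_iff.2 hk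
  have hπ : (Real.pi : ℂ) ≠ 0 := by exact_mod_cast Real.pi_ne_zero
  rw [opB, dInv]
  simp_rw [sourceB_indicator, mul_div_assoc]
  rw [integral_const_mul, ← mul_assoc, ← mul_assoc]
  congr 1
  push_cast
  field_simp

theorem opAB_indicator (Ω : Set ℂ) (σ : ℝ) {k : ℂ} (hk : k ≠ 0) (u : ℂ → ℂ) (z : ℂ) :
    opAB (Ω.indicator 1) σ k u z = (σ : ℂ) / (2 * Real.pi) ^ 2 *
      ∫ v, Complex.exp (-k * v - conj (-k * v)) *
        Ω.indicator (fun v => (z - v)⁻¹ * ∫ w, oscDensity Ω k u w / conj (v - w)) v := by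
  have hk' : (‖k‖ : ℂ) ≠ 0 := by exact_mod_cast norm_ne_zero_iff.2 hk
  have hπ : (Real.pi : ℂ) ≠ 0 := by exact_mod_cast Real.pi_ne_zero
  have h : ∀ v, sourceA (Ω.indicator 1) k (opB (Ω.indicator 1) σ k u) v / (z - v) =
      ((1 / ‖k‖ : ℝ) : ℂ) / 2 * ((σ : ℂ) / (2 * Real.pi)) *
      (Complex.exp (-k * v - conj (-k * v)) *
        Ω.indicator (fun v => (z - v)⁻¹ * ∫ w, oscDensity Ω k u w / conj (v - w)) v) := by
    intro v
    rw [sourceA, oscMul, opB_indicator Ω σ hk]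
    by_cases hv : v ∈ Ω
    · simp only [Set.indicator_of_mem hv, Pi.one_apply]; ring
    · simp [Set.indicator_of_notMem hv]
  rw [opAB, opA, dbarInv]
  simp_rw [h]
  rw [integral_const_mul, ← mul_assoc]
  congr 1
  push_cast
  field_simp

/-- Half a period of the oscillating factor `exp (-k z + conj (k z))`. -/
noncomputable def halfPeriod (k : ℂ) : ℂ := Complex.I * Real.pi / (2 * k)

/-- The product of `k` and the half period is `iπ/2`; subtracting the conjugate doubles it, so the
phase shifts by `π`. -/
theorem exp_add_halfPeriod {k : ℂ} (hk : k ≠ 0) (v : ℂ) :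
    Complex.exp (-k * (v + halfPeriod k) - conj (-k * (v + halfPeriod k))) =
      -Complex.exp (-k * v - conj (-k * v)) := by
  have h : -k * halfPeriod k = -(Complex.I * Real.pi / 2) := by
    rw [halfPeriod]; field_simp
  rw [mul_add, h, map_add, map_neg, map_div₀, map_mul conj Complex.I, Complex.conj_I,
    Complex.conj_ofReal, Complex.conj_ofNat, show ∀ a b : ℂ, a + -(Complex.I * Real.pi / 2) -
      (b + -(-Complex.I * Real.pi / 2)) = (a - b) - Real.pi * Complex.I by intros; ring,
    Complex.exp_sub_pi_mul_I]

theorem norm_halfPeriod (k : ℂ) : ‖halfPeriod k‖ = Real.pi / 2 / ‖k‖ := by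
  rw [halfPeriod, norm_div, norm_mul, norm_mul, Complex.norm_I, Complex.norm_real,
    Real.norm_of_nonneg Real.pi_pos.le, Complex.norm_ofNat]
  field_simp

theorem halfPeriod_ne_zero {k : ℂ} (hk : k ≠ 0) : halfPeriod k ≠ 0 := by
  rw [← norm_pos_iff, norm_halfPeriod]
  have := norm_pos_iff.2 hk
  positivity

/-! ### Absolute convergence -/

theorem ae_lintegral_newton_lt_top {p : ℝ} (hp : 1 < p) {Ω : Set ℂ} (hΩ : IsOpen Ω) {R : ℝ}
    (hR : Ω ⊆ Metric.ball 0 R) {f : ℂ → ENNReal} (hf : Measurable f)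
    (hfin : ∫⁻ w in Ω, f w ^ p ≠ ⊤) :
    ∀ᵐ z : ℂ, ∫⁻ w in Ω, ‖z - w‖ₑ⁻¹ * f w < ⊤ := by
  have hvol : volume Ω ≠ ⊤ := ((measure_mono hR).trans_lt measure_ball_lt_top).ne
  -- Any weight with `2 < p * ε + p` would do: it never vanishes, so finiteness almost everywhere
  -- passes to the potential itself.
  obtain ⟨C, hC, hCb⟩ := lintegral_newton_rpow_weight_domain_le hp (ε := 2) (by norm_num)
    (by linarith) hΩ.measurableSet hR hvol
  have hNm : Measurable fun v : ℂ => ∫⁻ w in Ω, ‖v - w‖ₑ⁻¹ * f w :=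
    Measurable.lintegral_prod_right' (f := fun q : ℂ × ℂ => ‖q.1 - q.2‖ₑ⁻¹ * f q.2) (by fun_prop)
  have h := ae_lt_top (by fun_prop) ((hCb f hf).trans_lt (ENNReal.mul_lt_top hC.lt_top
    hfin.lt_top)).ne
  filter_upwards [h] with z hz
  rw [ENNReal.rpow_lt_top_iff_of_pos (by linarith)] at hz
  by_contra htop
  rw [not_lt, top_le_iff] at htop
  rw [htop, ENNReal.mul_top (by simp [ENNReal.rpow_eq_zero_iff])] at hz
  exact lt_irrefl _ hz

theorem lintegral_rpow_ne_top_of_memLp {p : ℝ} (hp : 0 < p) {u : ℂ → ℂ}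
    (hu : MemLp u (ENNReal.ofReal p)) : ∫⁻ w, ‖u w‖ₑ ^ p ≠ ⊤ := by
  have h := lintegral_rpow_enorm_lt_top_of_eLpNorm_lt_top (by simpa using hp)
    ENNReal.ofReal_ne_top hu.2
  rw [ENNReal.toReal_ofReal hp.le] at h
  exact h.ne

theorem setLIntegral_enorm_oscDensity {Ω : Set ℂ} (hΩ : MeasurableSet Ω) (k : ℂ) (u : ℂ → ℂ)
    (g : ℂ → ENNReal → ENNReal) :
    ∫⁻ w in Ω, g w ‖oscDensity Ω k u w‖ₑ = ∫⁻ w in Ω, g w ‖u w‖ₑ := by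
  refine setLIntegral_congr_fun hΩ fun w hw => ?_
  simp only [enorm_oscDensity, Set.indicator_of_mem hw]

theorem measurable_oscDensity {Ω : Set ℂ} (hΩ : MeasurableSet Ω) (k : ℂ) {u : ℂ → ℂ}
    (hu : Measurable u) : Measurable (oscDensity Ω k u) :=
  measurable_oscMul (hu.indicator hΩ)

theorem ae_lintegral_newton_oscDensity_lt_top {p : ℝ} (hp : 1 < p) {Ω : Set ℂ} (hΩ : IsOpen Ω)
    {R : ℝ} (hR : Ω ⊆ Metric.ball 0 R) (k : ℂ) {u : ℂ → ℂ} (hum : Measurable u)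
    (hu : MemLp u (ENNReal.ofReal p)) :
    ∀ᵐ z : ℂ, ∫⁻ w in Ω, ‖z - w‖ₑ⁻¹ * ‖oscDensity Ω k u w‖ₑ < ⊤ := by
  refine ae_lintegral_newton_lt_top hp hΩ hR (measurable_oscDensity hΩ.measurableSet k hum).enorm ?_
  rw [setLIntegral_enorm_oscDensity hΩ.measurableSet k u fun _ x => x ^ p]
  exact ne_top_of_le_ne_top (lintegral_rpow_ne_top_of_memLp (by linarith) hu)
    (lintegral_mono' Measure.restrict_le_self le_rfl)

theorem enorm_coe_sign_div_le {σ : ℝ} (hσ : σ = 1 ∨ σ = -1) (n : ℕ) :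
    ‖(σ : ℂ) / (2 * Real.pi) ^ n‖ₑ ≤ 1 := by
  have hσ1 : |σ| = 1 := by rcases hσ with rfl | rfl <;> simp
  rw [← ofReal_norm, ← ENNReal.ofReal_one]
  refine ENNReal.ofReal_le_ofReal ?_
  rw [norm_div, Complex.norm_real, Real.norm_eq_abs, hσ1, norm_pow, norm_mul, Complex.norm_ofNat,
    Complex.norm_real, Real.norm_of_nonneg Real.pi_pos.le]
  refine div_le_one_of_le₀ (one_le_pow₀ ?_) (by positivity)
  linarith [Real.pi_gt_three]

theorem enorm_opB_indicator_le {Ω : Set ℂ} (hΩ : MeasurableSet Ω) {σ : ℝ} (hσ : σ = 1 ∨ σ = -1)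
    {k : ℂ} (hk : k ≠ 0) (u : ℂ → ℂ) (v : ℂ) :
    ‖opB (Ω.indicator 1) σ k u v‖ₑ ≤ ∫⁻ w in Ω, ‖v - w‖ₑ⁻¹ * ‖u w‖ₑ := by
  rw [opB_indicator Ω σ hk, enorm_mul]
  have h1 := enorm_coe_sign_div_le hσ 1
  rw [pow_one] at h1
  refine (mul_le_of_le_one_left' h1).trans ?_
  refine (enorm_integral_le_lintegral_enorm _).trans ?_
  rw [← lintegral_indicator hΩ]
  refine lintegral_mono fun w => ?_
  rw [div_eq_mul_inv, enorm_mul, enorm_oscDensity]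
  by_cases hw : w ∈ Ω
  · rw [Set.indicator_of_mem hw, Set.indicator_of_mem hw, mul_comm]
    gcongr
    exact (enorm_inv_le _).trans_eq (by rw [enorm_conj])
  · simp [hw]

theorem enorm_inv_norm_div_two_le {k : ℂ} (hk : 1 ≤ ‖k‖) : ‖((1 / ‖k‖ : ℝ) : ℂ) / 2‖ₑ ≤ 1 := by
  rw [← ofReal_norm, ← ENNReal.ofReal_one]
  refine ENNReal.ofReal_le_ofReal ?_
  rw [norm_div, Complex.norm_real, Complex.norm_ofNat, Real.norm_of_nonneg (by positivity)]
  have : 1 / ‖k‖ ≤ 1 := by rw [div_le_one (by linarith)]; exact hk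
  linarith

/-- No oscillation is needed: `|Bu|` is at most the Newton potential of `|u|` on `Ω`, which is again
in `L^p(Ω)`, so finiteness of the potential applies a second time. -/
theorem opABConverges_of_measurable {p : ℝ} (hp : 1 < p) {Ω : Set ℂ} (hΩ : IsOpen Ω) {R : ℝ}
    (hR : Ω ⊆ Metric.ball 0 R) {σ : ℝ} (hσ : σ = 1 ∨ σ = -1) {k : ℂ} (hk : 1 ≤ ‖k‖) {u : ℂ → ℂ}
    (hum : Measurable u) (hu : MemLp u (ENNReal.ofReal p)) :
    OpABConverges (Ω.indicator 1) σ k u := by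
  have hk0 : k ≠ 0 := norm_pos_iff.1 (by linarith)
  have hq : Measurable (Ω.indicator (1 : ℂ → ℂ)) := measurable_one.indicator hΩ.measurableSet
  have hvol : volume Ω ≠ ⊤ := ((measure_mono hR).trans_lt measure_ball_lt_top).ne
  refine ⟨?_, ?_⟩
  · filter_upwards [ae_lintegral_newton_oscDensity_lt_top hp hΩ hR k hum hu] with z hz
    refine ⟨((measurable_sourceB hq hum).div
      (Complex.continuous_conj.measurable.comp (by fun_prop))).aestronglyMeasurable,
      lt_of_le_of_lt ?_ hz⟩
    rw [← lintegral_indicator hΩ.measurableSet]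
    refine lintegral_mono fun w => ?_
    beta_reduce
    rw [sourceB_indicator, div_eq_mul_inv, enorm_mul, enorm_mul]
    by_cases hw : w ∈ Ω
    · rw [Set.indicator_of_mem hw, mul_comm]
      gcongr
      · exact (enorm_inv_le _).trans_eq (by rw [enorm_conj])
      · exact mul_le_of_le_one_left' (enorm_inv_norm_div_two_le hk)
    · simp [enorm_oscDensity, hw]
  · set N : ℂ → ENNReal := fun v => ∫⁻ w in Ω, ‖v - w‖ₑ⁻¹ * ‖u w‖ₑ
    have hNm : Measurable N := Measurable.lintegral_prod_right' (f := fun q : ℂ × ℂ =>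
      ‖q.1 - q.2‖ₑ⁻¹ * ‖u q.2‖ₑ) (by fun_prop)
    obtain ⟨C, hC, hCb⟩ := lintegral_newton_rpow_domain_le hp hvol
    have hNfin : ∫⁻ v in Ω, N v ^ p ≠ ⊤ := by
      refine ne_top_of_le_ne_top (ENNReal.mul_ne_top hC
        (lintegral_rpow_ne_top_of_memLp (by linarith) hu)) ((hCb _ hum.enorm).trans ?_)
      gcongr
      exact Measure.restrict_le_self
    filter_upwards [ae_lintegral_newton_lt_top hp hΩ hR hNm hNfin] with z hz
    refine ⟨((measurable_sourceA hq (measurable_opB hq hum)).div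
      (by fun_prop)).aestronglyMeasurable, lt_of_le_of_lt ?_ hz⟩
    rw [← lintegral_indicator hΩ.measurableSet]
    refine lintegral_mono fun w => ?_
    beta_reduce
    rw [div_eq_mul_inv, enorm_mul, sourceA, oscMul, enorm_mul, ← ofReal_norm (Complex.exp _),
      norm_exp_sub_conj, ENNReal.ofReal_one, one_mul]
    by_cases hw : w ∈ Ω
    · rw [Set.indicator_of_mem hw, Set.indicator_of_mem hw, Pi.one_apply, mul_one, enorm_mul,
        mul_comm]
      gcongr
      · exact enorm_inv_le _
      · exact (mul_le_of_le_one_left' (enorm_inv_norm_div_two_le hk)).trans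
          (enorm_opB_indicator_le hΩ.measurableSet hσ hk0 u w)
    · simp [hw]

theorem enorm_opAB_indicator_le {p : ℝ} (hp : 1 < p) {Ω : Set ℂ} (hΩ : IsOpen Ω)
    (hc : Convex ℝ Ω) {R : ℝ} (hR : Ω ⊆ Metric.ball 0 R) {σ : ℝ} (hσ : σ = 1 ∨ σ = -1) {k : ℂ}
    (hk : k ≠ 0) {u : ℂ → ℂ} (hum : Measurable u) (hu : MemLp u (ENNReal.ofReal p)) (z : ℂ) :
    ‖opAB (Ω.indicator 1) σ k u z‖ₑ ≤
      90 * majorant Ω (halfPeriod k) (fun w => ‖oscDensity Ω k u w‖ₑ) z := by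
  rw [opAB_indicator Ω σ hk, enorm_mul]
  refine (mul_le_of_le_one_left' (enorm_coe_sign_div_le hσ 2)).trans ?_
  refine enorm_integral_osc_cauchy_le hΩ hc (e := fun v => Complex.exp (-k * v - conj (-k * v)))
    (halfPeriod_ne_zero hk) (fun v => norm_exp_sub_conj _) (exp_add_halfPeriod hk)
    (measurable_oscDensity hΩ.measurableSet k hum) (fun w hw => by simp [oscDensity, oscMul, hw])
    (ae_lintegral_newton_oscDensity_lt_top hp hΩ hR k hum hu) z

/-! ### The operator bound -/

theorem measurable_japaneseBracket : Measurable japaneseBracket := by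
  unfold japaneseBracket; fun_prop

theorem enorm_japaneseBracket_rpow_neg_le {ε : ℝ} (hε : 0 ≤ ε) (z : ℂ) :
    ‖japaneseBracket z ^ (-ε)‖ₑ ≤ 2 ^ ε * (1 + ‖z‖ₑ) ^ (-ε) := by
  have h1 : (1 + ‖z‖) / 2 ≤ japaneseBracket z := by
    refine Real.le_sqrt_of_sq_le ?_
    nlinarith [sq_nonneg (‖z‖ - 1), norm_nonneg z]
  have h0 : 0 < (1 + ‖z‖) / 2 := by positivity
  have hj : 0 < japaneseBracket z := h0.trans_le h1
  have h2 : (1 + ‖z‖ₑ) = 2 * ENNReal.ofReal ((1 + ‖z‖) / 2) := by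
    rw [show (2 : ENNReal) = ENNReal.ofReal 2 by simp, ← ENNReal.ofReal_mul zero_le_two,
      mul_div_cancel₀ _ (by norm_num), ENNReal.ofReal_add zero_le_one (norm_nonneg z), ofReal_norm,
      ENNReal.ofReal_one]
  rw [Real.enorm_of_nonneg (by positivity), ← ENNReal.ofReal_rpow_of_pos hj, h2,
    ENNReal.mul_rpow_of_ne_top (by simp) (by simp), ← mul_assoc,
    ← ENNReal.rpow_add _ _ (by simp) (by simp), add_neg_cancel, ENNReal.rpow_zero, one_mul,
    ENNReal.rpow_neg, ENNReal.rpow_neg, ENNReal.inv_le_inv]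
  gcongr

theorem isBigOInvAbs_opAB {p ε : ℝ} (hp : 1 < p) (hε : 0 ≤ ε) (hpε : 2 < p * ε + p) {Ω : Set ℂ}
    (hΩ : IsOpen Ω) (hc : Convex ℝ Ω) {R : ℝ} (hR : Ω ⊆ Metric.ball 0 R) {σ : ℝ}
    (hσ : σ = 1 ∨ σ = -1) : IsBigOInvAbs (opAB (Ω.indicator 1) σ) p ε := by
  have hp0 : 0 < p := by linarith
  obtain ⟨C, hC, hCb⟩ := lintegral_majorant_rpow_le hp hε hpε hΩ hc hR
  have hK : 2 ^ ε * 90 * C ^ (1 / p) ≠ ⊤ := ENNReal.mul_ne_top (ENNReal.mul_ne_top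
    (ENNReal.rpow_ne_top_of_nonneg hε (by simp)) (by simp))
    (ENNReal.rpow_ne_top_of_nonneg (by positivity) hC)
  -- `2 ^ ε` compares `⟨z⟩` with `1 + |z|`, `90` is the oscillatory bound, and `π / 2` comes from
  -- `‖halfPeriod k‖ = (π / 2) / ‖k‖`.
  refine ⟨(2 ^ ε * 90 * C ^ (1 / p)).toReal * (Real.pi / 2), fun k hk u hu => ?_⟩
  have hk0 : k ≠ 0 := norm_pos_iff.1 (by linarith)
  obtain ⟨v, hvm, huv⟩ := hu.1
  have hv : MemLp v (ENNReal.ofReal p) := hu.ae_eq huv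
  rw [opAB_congr_ae huv, eLpNorm_congr_ae huv]
  have hq : Measurable (Ω.indicator (1 : ℂ → ℂ)) := measurable_one.indicator hΩ.measurableSet
  have hABm : Measurable (opAB (Ω.indicator 1) σ k v) :=
    measurable_opA hq (measurable_opB hq hvm.measurable)
  have hm : Measurable fun z => (japaneseBracket z ^ (-ε)) • opAB (Ω.indicator 1) σ k v z :=
    (measurable_japaneseBracket.pow_const _).smul hABm
  set U : ℂ → ENNReal := fun w => ‖oscDensity Ω k v w‖ₑ with hU
  have hUm : Measurable U := (measurable_oscDensity hΩ.measurableSet k hvm.measurable).enorm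
  have hbound : eLpNorm (fun z => (japaneseBracket z ^ (-ε)) • opAB (Ω.indicator 1) σ k v z)
      (ENNReal.ofReal p) volume ≤
      ENNReal.ofReal ((2 ^ ε * 90 * C ^ (1 / p)).toReal * (Real.pi / 2) / ‖k‖) *
        eLpNorm v (ENNReal.ofReal p) volume := by
    rw [eLpNorm_eq_lintegral_rpow_enorm_toReal (by simpa using hp0) ENNReal.ofReal_ne_top,
      eLpNorm_eq_lintegral_rpow_enorm_toReal (by simpa using hp0) ENNReal.ofReal_ne_top,
      ENNReal.toReal_ofReal hp0.le, mul_div_assoc, ENNReal.ofReal_mul ENNReal.toReal_nonneg,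
      ENNReal.ofReal_toReal hK, ← norm_halfPeriod, ofReal_norm]
    have hcancel : ∀ x : ENNReal, (x ^ p) ^ (1 / p) = x := fun x => by
      rw [← ENNReal.rpow_mul, mul_one_div_cancel hp0.ne', ENNReal.rpow_one]
    have hip : 0 ≤ 1 / p := by positivity
    calc (∫⁻ z, ‖(japaneseBracket z ^ (-ε)) • opAB (Ω.indicator 1) σ k v z‖ₑ ^ p) ^ (1 / p)
        ≤ (∫⁻ z, (2 ^ ε * 90) ^ p *
            ((1 + ‖z‖ₑ) ^ (-ε) * majorant Ω (halfPeriod k) U z) ^ p) ^ (1 / p) := by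
          gcongr with z
          rw [← ENNReal.mul_rpow_of_nonneg _ _ hp0.le]
          gcongr
          rw [enorm_smul]
          calc _ ≤ 2 ^ ε * (1 + ‖z‖ₑ) ^ (-ε) * (90 * majorant Ω (halfPeriod k) U z) :=
                mul_le_mul' (enorm_japaneseBracket_rpow_neg_le hε z)
                  (enorm_opAB_indicator_le hp hΩ hc hR hσ hk0 hvm.measurable hv z)
            _ = _ := by ring
      _ = 2 ^ ε * 90 * (∫⁻ z, ((1 + ‖z‖ₑ) ^ (-ε) * majorant Ω (halfPeriod k) U z) ^ p) ^ (1 / p) := by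
          rw [lintegral_const_mul' _ _ (ENNReal.rpow_ne_top_of_nonneg hp0.le (ENNReal.mul_ne_top
            (ENNReal.rpow_ne_top_of_nonneg hε (by simp)) (by simp))),
            ENNReal.mul_rpow_of_nonneg _ _ hip, hcancel]
      _ ≤ 2 ^ ε * 90 * (C * ‖halfPeriod k‖ₑ ^ p * ∫⁻ w, ‖v w‖ₑ ^ p) ^ (1 / p) := by
          gcongr
          refine (hCb _ (halfPeriod_ne_zero hk0) U hUm).trans ?_
          refine mul_le_mul_right ?_ _
          rw [hU, setLIntegral_enorm_oscDensity hΩ.measurableSet k v fun _ x => x ^ p]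
          exact lintegral_mono' Measure.restrict_le_self le_rfl
      _ = _ := by
          rw [ENNReal.mul_rpow_of_nonneg _ _ hip, ENNReal.mul_rpow_of_nonneg _ _ hip, hcancel]
          ring
  exact ⟨⟨hm.aestronglyMeasurable, hbound.trans_lt (ENNReal.mul_lt_top ENNReal.ofReal_lt_top hv.2)⟩,
    hbound⟩

theorem theorem2p2 (Ω : Set ℂ) (hΩ : IsStrictlyConvexSmoothDomain Ω)
    (σ : ℝ) (hσ : σ = 1 ∨ σ = -1) :
    (∀ p : ℝ, 1 < p → ∀ k : ℂ, 1 ≤ ‖k‖ → ∀ u : ℂ → ℂ, MemLp u (ENNReal.ofReal p) volume →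
      OpABConverges (Ω.indicator 1) σ k u) ∧
    (∀ p : ℝ, 2 < p → IsBigOInvAbs (opAB (Ω.indicator 1) σ) p 0) ∧
    (∀ p : ℝ, 1 < p → p ≤ 2 → ∀ ε : ℝ, 2 / p - 1 < ε →
      IsBigOInvAbs (opAB (Ω.indicator 1) σ) p ε) := by
  obtain ⟨R, hR⟩ := hΩ.isBounded.subset_ball 0
  refine ⟨fun p hp k hk u hu => ?_, fun p hp => ?_, fun p hp hp2 ε hε => ?_⟩
  · obtain ⟨v, hvm, huv⟩ := hu.1
    rw [opABConverges_congr_ae huv]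
    exact opABConverges_of_measurable hp hΩ.isOpen hR hσ hk hvm.measurable (hu.ae_eq huv)
  · exact isBigOInvAbs_opAB (by linarith) le_rfl (by linarith) hΩ.isOpen hΩ.convex hR hσ
  · have hp0 : 0 < p := by linarith
    -- Since `p ≤ 2`, the hypothesis `2 / p - 1 < ε` also forces `ε` to be nonnegative.
    have h1 : 1 ≤ 2 / p := by rw [le_div_iff₀ hp0]; linarith
    refine isBigOInvAbs_opAB hp (by linarith) ?_ hΩ.isOpen hΩ.convex hR hσ
    have h2 : 2 / p < ε + 1 := by linarith
    rw [div_lt_iff₀ hp0] at h2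
    linarith
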